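/- **Setting.** Let $\{1,\dots,p\}$ be partitioned into groups $\mathcal J_1,\dots,\mathcal J_m$, let $A\in\mathbb R^{n\times p}$ and $b=A\overline x+\varepsilon$ with $\overline x\neq 0$. Put $\mathcal G(x)=(\|x_{\mathcal J_1}\|,\dots,\|x_{\mathcal J_m}\|)$ (Euclidean norms), $\overline S=\operatorname{supp}\mathcal G(\overline x)$, $\overline r=|\overline S|\ge 1$, $\|\mathcal J\|_\infty=\max_i|\mathcal J_i|$, let $\|A\|_{2,\infty}$ be the largest Euclidean column norm of $A$, and $\Omega=\{x:\|x\|_\infty\le R\}$ with $R>0$. Let $\phi:\mathbb R\to(-\infty,+\infty]$ be a closed proper convex function with $[0,1]\subseteq\operatorname{int}(\operatorname{dom}\phi)$ and $\phi(1)=1$ that has a unique minimizer $t^*_\phi$ over $[0,1]$, with $\phi(t_\phi^*)=0$. Let $\overline t_\phi$ be the smallest $t\in[t_\phi^*,1)$ with $\frac1{1-t_\phi^*}\in\partial\phi(t)$, and $\phi'_-(1)$ the left derivative of $\phi$ at $1$. *GEP-MSCRA* with parameters $\nu,\rho$: start from any $w^0\in[0,\overline t_\phi]^m$; for $k=1,2,\dots$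 let $$x^k\in\arg\min_{x\in\Omega}\Big\{\tfrac1{2n}\|Ax-b\|^2+\lambda^{k-1}\sum_{i=1}^m(1-w_i^{k-1})\|x_{\mathcal J_i}\|\Big\},\qquad w_i^k\in\arg\min_{v\in[0,1]}\{\phi(v)-\rho v\|x^k_{\mathcal J_i}\|\},$$ where $\lambda^0=\nu^{-1}$ and $\lambda^k=\rho\nu^{-1}$ for $k\ge1$. An *oracle LS solution* is $x^{\rm LS}\in\arg\min\{\frac1{2n}\|Ax-b\|^2:\operatorname{supp}\mathcal G(x)\subseteq\overline S\}$. For $l>0$ let $\mathcal C(\overline S,l)$ be the set of $z\in\mathbb R^p$ for which some $S\supseteq\overline S$ with $|S|\le l$ satisfies $\sum_{i\notin S}\|z_{\mathcal J_i}\|\le\frac2{1-\overline t_\phi}\sum_{i\in S}\|z_{\mathcal J_i}\|$. Say that $A$ has the *RSC of constant* $\kappa>0$ if $\frac1{2n}\|Az\|^2\ge\kappa\|z\|^2$ for all $z\in\mathcal C(\overline S,1.5\,\overline r)$. **Recovery property $\mathcal R(A,\kappa)$.** Let $\varepsilon_1,\dots,\varepsilon_n$ be independent random variables with $\mathbb E[e^{t\varepsilon_r}]\le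 e^{\sigma^2t^2/2}$ for all $r$ and all $t\in\mathbb R$, where $\sigma>0$; let $\eta\in(0,1)$ and $$K=\frac{\sigma}{n}\sqrt{2\|\mathcal J\|_\infty\log(2p/\eta)}\;\|A\|_{2,\infty}.$$ Then there is an event of probability at least $1-2\eta$ on which the following holds for all $R>0$ and all $\nu,\rho$ with $$\frac{(1-t^*_\phi)(1+3\sqrt5)}{4\kappa}<\nu\le\frac{1-\overline t_\phi}{2K},\qquad \max\Big(\frac{2\phi'_-(1)}{\min_{i\in\overline S}\|\overline x_{\mathcal J_i}\|},\frac{4K\nu}{1-\overline t_\phi}\Big)<\rho\le\sqrt{\frac{4\kappa\nu}{(1-t_\phi^*)(1+3\sqrt5)}}:$$ if $x^{\rm LS}\in\Omega$, then every sequence generated by the GEP-MSCRA satisfies $x^k=x^{\rm LS}$ and $\operatorname{supp}(\mathcal G(x^k))=\overline S$ for all $k\ge\max(\overline k,2)$, where $$\overline k=\Big\lceil\frac{0.5\ln\overline r}{\ln(6\nu\kappa)-\ln[\max(1,\rho)\,\rho\,(1-t^*_\phi)(1+3\sqrt5)]}\Big\rceil+1 .$$ (If $\overline r\ge2$, then $\overline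 k\ge2$ and the maximum is $\overline k$.) **Corollary.** Fix $\phi$ as above. 1. (Fixed design.) If $A$ has the RSC of constant $\kappa>0$, then $\mathcal R(A,\kappa)$ holds. 2. (Gaussian design.) For all $0<a_1\le a_2$ and $\gamma>0$ there are constants $\kappa,c,c_1,c_2>0$, depending only on $\phi,a_1,a_2,\gamma$, such that the following holds for all $n,p,m$, all partitions, all $\overline x\ne0$, and all positive definite $\Sigma\in\mathbb R^{p\times p}$ with eigenvalues in $[a_1,a_2]$. Suppose that $\|\mathcal J\|_\infty\,\overline r\le\gamma\sum_{i\in\overline S}|\mathcal J_i|$ and $$n>c\sum_{i\in\overline S}|\mathcal J_i|\log p .$$ If the rows of $A$ are independent with law $N(0,\Sigma)$, then with probability greater than $1-c_1e^{-c_2n}$ the matrix $A$ has the RSC of constant $\kappa$ and $\mathcal R(A,\kappa)$ holds (the noise probability $1-2\eta$ in $\mathcal R(A,\kappa)$ being for the given $A$). -/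

import Mathlib

open MeasureTheory ProbabilityTheory

universe u

noncomputable section

/-! ### The function family `Φ` -/

/-- `φ ∈ Φ`: a closed (lower semicontinuous) proper convex function `ℝ → (-∞, +∞]` whose effective
domain contains `[0,1]` in its interior, with `φ 1 = 1`, having a unique minimizer over `[0,1]`,
at which its value is `0`.  Convexity is convexity of the epigraph. -/
structure MemPhi (φ : ℝ → EReal) : Prop where
  closed : LowerSemicontinuous φ
  ne_bot : ∀ t, φ t ≠ ⊥
  convex : Convex ℝ {q : ℝ × ℝ | φ q.1 ≤ (q.2 : EReal)}
  dom : Set.Icc (0 : ℝ) 1 ⊆ interior {t | φ t ≠ ⊤}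
  map_one : φ 1 = 1
  exists_min : ∃ t ∈ Set.Icc (0 : ℝ) 1, φ t = 0 ∧ ∀ s ∈ Set.Icc (0 : ℝ) 1, s ≠ t → φ t < φ s

/-- `t_φ^*`, the (unique, for `φ ∈ Φ`) minimizer of `φ` over `[0,1]`. -/
def tStar (φ : ℝ → EReal) : ℝ :=
  sInf {t | t ∈ Set.Icc (0 : ℝ) 1 ∧ ∀ s ∈ Set.Icc (0 : ℝ) 1, φ t ≤ φ s}

/-- `s ∈ ∂φ(t)`, for a point `t` of the effective domain. -/
def IsSubgradient (φ : ℝ → EReal) (t s : ℝ) : Prop :=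
  ∀ y : ℝ, φ t + ((s * (y - t) : ℝ) : EReal) ≤ φ y

/-- `t̄_φ`, the smallest `t ∈ [t_φ^*, 1)` with `1 / (1 - t_φ^*) ∈ ∂φ(t)`. -/
def tBar (φ : ℝ → EReal) : ℝ :=
  sInf {t | t ∈ Set.Ico (tStar φ) 1 ∧ IsSubgradient φ t (1 / (1 - tStar φ))}

/-- The left derivative `φ'_-(1)` (`φ` is finite around `1` when `φ ∈ Φ`). -/
def leftDerivOne (φ : ℝ → EReal) : ℝ :=
  derivWithin (fun t => (φ t).toReal) (Set.Iio 1) 1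

/-! ### Groups

A partition of the `p` coordinates into the groups `J_1, …, J_m` is given by the map `grp` that
sends a coordinate to the number of its group: `J_i = {j | grp j = i}`. -/

variable {n p m : ℕ}

/-- `|J_i|`. -/
def groupSize (grp : Fin p → Fin m) (i : Fin m) : ℕ :=
  (Finset.univ.filter (fun j => grp j = i)).card

/-- `‖J‖_∞ = max_i |J_i|`. -/
def maxGroupSize (grp : Fin p → Fin m) : ℕ :=
  Finset.univ.sup (groupSize grp)

/-- The Euclidean norm `‖x_{J_i}‖`; as a function of `i` this is the vector `G(x)`. -/
def gnorm (grp : Fin p → Fin m) (x : Fin p → ℝ) (i : Fin m) : ℝ :=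
  √(∑ j ∈ Finset.univ.filter (fun j => grp j = i), x j ^ 2)

/-- `supp(G(x))`, the group support of `x`. -/
def groupSupport (grp : Fin p → Fin m) (x : Fin p → ℝ) : Finset (Fin m) :=
  Finset.univ.filter (fun i => gnorm grp x i ≠ 0)

/-- `min_{i ∈ supp(G(x))} ‖x_{J_i}‖`, for `x ≠ 0`. -/
def minGroupNorm (grp : Fin p → Fin m) (x : Fin p → ℝ) : ℝ :=
  sInf (gnorm grp x '' (groupSupport grp x : Set (Fin m)))

/-! ### Restricted strong convexity -/

/-- The cone `C(S, l)` (with the constant `2 / (1 - tb)`). -/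
def cone (tb : ℝ) (grp : Fin p → Fin m) (S : Finset (Fin m)) (l : ℝ) : Set (Fin p → ℝ) :=
  {z | ∃ T : Finset (Fin m), S ⊆ T ∧ (T.card : ℝ) ≤ l ∧
    ∑ i ∈ Tᶜ, gnorm grp z i ≤ 2 / (1 - tb) * ∑ i ∈ T, gnorm grp z i}

/-- `A` satisfies the RSC of constant `κ` in the set `C`: `‖A z‖² / (2n) ≥ κ ‖z‖²` on `C`. -/
def RSC (A : Matrix (Fin n) (Fin p) ℝ) (κ : ℝ) (C : Set (Fin p → ℝ)) : Prop :=
  ∀ z ∈ C, κ * ∑ j, z j ^ 2 ≤ 1 / (2 * (n : ℝ)) * ∑ r, (A.mulVec z) r ^ 2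

/-! ### Least squares loss, oracle solution, and the algorithm -/

/-- `f(x) = ‖A x - b‖² / (2n)`. -/
def loss (A : Matrix (Fin n) (Fin p) ℝ) (b : Fin n → ℝ) (x : Fin p → ℝ) : ℝ :=
  1 / (2 * (n : ℝ)) * ∑ r, ((A.mulVec x) r - b r) ^ 2

/-- The box `Ω = {x | ‖x‖_∞ ≤ R}`. -/
def box (p : ℕ) (R : ℝ) : Set (Fin p → ℝ) := {x | ∀ j, |x j| ≤ R}

/-- `x` is an oracle least squares solution `x^LS`: it minimizes the loss over all vectors whose
group support is contained in `S`. -/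
def IsOracleLS (grp : Fin p → Fin m) (A : Matrix (Fin n) (Fin p) ℝ) (b : Fin n → ℝ)
    (S : Finset (Fin m)) (x : Fin p → ℝ) : Prop :=
  groupSupport grp x ⊆ S ∧ ∀ y : Fin p → ℝ, groupSupport grp y ⊆ S → loss A b x ≤ loss A b y

/-- `λ^0 = 1/ν` and `λ^k = ρ/ν` for `k ≥ 1`. -/
def stepLambda (ν ρ : ℝ) (k : ℕ) : ℝ := if k = 0 then ν⁻¹ else ρ * ν⁻¹

/-- `x^1, x^2, …` and `w^0, w^1, …` are produced by the multi-stage convex relaxation method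
GEP-MSCRA with parameters `ν`, `ρ` on the data `A`, `b`, with box radius `R`
(the value `x 0` is not used). -/
structure IsGEPMSCRA (φ : ℝ → EReal) (grp : Fin p → Fin m) (A : Matrix (Fin n) (Fin p) ℝ)
    (b : Fin n → ℝ) (R ν ρ : ℝ) (x : ℕ → Fin p → ℝ) (w : ℕ → Fin m → ℝ) : Prop where
  init : ∀ i, w 0 i ∈ Set.Icc 0 (tBar φ)
  x_mem : ∀ k, x (k + 1) ∈ box p R
  x_min : ∀ k, ∀ y ∈ box p R,
    loss A b (x (k + 1)) + stepLambda ν ρ k * ∑ i, (1 - w k i) * gnorm grp (x (k + 1)) i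
      ≤ loss A b y + stepLambda ν ρ k * ∑ i, (1 - w k i) * gnorm grp y i
  w_mem : ∀ k i, w (k + 1) i ∈ Set.Icc (0 : ℝ) 1
  w_min : ∀ k i, ∀ v ∈ Set.Icc (0 : ℝ) 1,
    (φ (w (k + 1) i)).toReal - ρ * w (k + 1) i * gnorm grp (x (k + 1)) i
      ≤ (φ v).toReal - ρ * v * gnorm grp (x (k + 1)) i

/-! ### The noise level and the iteration bound -/

/-- `‖A‖_{2,∞}`, the largest Euclidean norm of a column. -/
def maxColNorm (A : Matrix (Fin n) (Fin p) ℝ) : ℝ := ⨆ j, √(∑ r, A r j ^ 2)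

/-- `K = (σ/n) √(2 ‖J‖_∞ log(2p/η)) ‖A‖_{2,∞}`. -/
def noiseLevel (grp : Fin p → Fin m) (A : Matrix (Fin n) (Fin p) ℝ) (σ η : ℝ) : ℝ :=
  σ / (n : ℝ) * √(2 * (maxGroupSize grp : ℝ) * Real.log (2 * (p : ℝ) / η)) * maxColNorm A

/-- `k̄ = ⌈0.5 ln r̄ / (ln(6νκ) - ln(max(1,ρ) ρ (1 - ts) (1 + 3√5)))⌉ + 1`. -/
def kBar (ts κ ν ρ : ℝ) (r : ℕ) : ℕ :=
  ⌈0.5 * Real.log (r : ℝ) /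
    (Real.log (6 * ν * κ) - Real.log (max 1 ρ * ρ * (1 - ts) * (1 + 3 * √5)))⌉₊ + 1

/-- Oracle recovery for the design `A`, true vector `xbar` and constant `κ`: for independent
sub-Gaussian noise `ε` with parameter `σ` and every `η ∈ (0,1)` there is an event of probability at
least `1 - 2η` on which, for all `ν` and `ρ` in the stated windows, every run of the GEP-MSCRA on
`b = A xbar + ε` reaches, from iteration `max(k̄, 2)` on, the oracle least squares solution
(if that lies in the box), and has the group support of `xbar`. -/
def OracleRecovery (φ : ℝ → EReal) (grp : Fin p → Fin m) (A : Matrix (Fin n) (Fin p) ℝ)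
    (κ : ℝ) (xbar : Fin p → ℝ) : Prop :=
  ∀ (Ω : Type u) (_ : MeasurableSpace Ω) (P : Measure Ω) (_ : IsProbabilityMeasure P)
    (ε : Fin n → Ω → ℝ) (σ : NNReal) (η : ℝ),
    0 < σ → 0 < η → η < 1 →
    (∀ r, Measurable (ε r)) → iIndepFun ε P → (∀ r, HasSubgaussianMGF (ε r) (σ ^ 2) P) →
    ∃ E : Set Ω, MeasurableSet E ∧ 1 - 2 * η ≤ P.real E ∧
      ∀ ω ∈ E, ∀ R ν ρ : ℝ, 0 < R →
        (1 - tStar φ) * (1 + 3 * √5) / (4 * κ) < ν →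
        ν ≤ (1 - tBar φ) / (2 * noiseLevel grp A σ η) →
        max (2 * leftDerivOne φ / minGroupNorm grp xbar)
          (4 * noiseLevel grp A σ η * ν / (1 - tBar φ)) < ρ →
        ρ ≤ √(4 * κ * ν / ((1 - tStar φ) * (1 + 3 * √5))) →
        ∀ xLS : Fin p → ℝ,
          IsOracleLS grp A (fun r => (A.mulVec xbar) r + ε r ω) (groupSupport grp xbar) xLS →
          xLS ∈ box p R →
          ∀ (x : ℕ → Fin p → ℝ) (w : ℕ → Fin m → ℝ),
            IsGEPMSCRA φ grp A (fun r => (A.mulVec xbar) r + ε r ω) R ν ρ x w →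
            ∀ k, kBar (tStar φ) κ ν ρ (groupSupport grp xbar).card ≤ k → 2 ≤ k →
              x k = xLS ∧ groupSupport grp (x k) = groupSupport grp xbar

/-- The `Σ`-Gaussian ensemble: `n` independent rows with law `N(0, Sig)`. -/
def gaussianEnsemble (n : ℕ) (Sig : Matrix (Fin p) (Fin p) ℝ) :
    Measure (Fin n → EuclideanSpace ℝ (Fin p)) :=
  Measure.pi (fun _ => multivariateGaussian 0 Sig)

/-- The matrix with the given rows. -/
def ofRows (Z : Fin n → EuclideanSpace ℝ (Fin p)) : Matrix (Fin n) (Fin p) ℝ :=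
  Matrix.of (fun r j => Z r j)

end

noncomputable section

variable {n p m : ℕ}

/-! ### The real-valued function on the effective domain -/

/-! Fixed design. Write h = 1 - t_φ^* and let S be the group support of the true vector. Convexity
of φ turns the weight update into a thresholding rule: a group with ρ h ‖x_i‖ < 1 gets weight at
most t̄_φ, and a group with ρ ‖x_i‖ > φ'_-(1) gets weight 1. Call a group wrong if it lies in S with
weight below 1, or outside S with weight above t̄_φ. As long as at most half of |S| groups outside S
are wrong, the next error vector lies in the cone, and RSC with Cauchy–Schwarz bounds its squared
norm by a multiple of the number of wrong groups (`stage_error_le`). Conversely, each wrong group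
accounts for a fixed amount of the squared error of the stage that produced it (`card_wrong_le`).
Composing the two gives a geometric rate. The number of wrong groups is an integer, so once it is
below 1 it is 0, and the next stage returns the oracle solution exactly
(`recovery_of_noise_bounds`).

The noise matters only through the oracle error on S and the loss gradient at the oracle solution
off S. Each coordinate of these is, up to scale, one fixed linear functional of ε of norm at most
the largest column norm (`exists_noise_functionals`), so sub-Gaussian tails and a union bound over p
coordinates suffice.

Gaussian design. Chernoff bounds control ‖A v‖² from below for the at most (2p)^D sums v of D signed
basis vectors, with D proportional to the number s of coordinates in the groups of S, and from above
for the basis itself. Maurey's averaging argument (`neg_le_of_signedSum_nonneg`) carries the lower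
bound over to every z whose squared ℓ¹ norm is at most a multiple of s ‖z‖², and the cone consists
of such vectors (`sq_sum_abs_le_of_mem_cone`). -/

theorem MemPhi.convexOn_toReal {φ : ℝ → EReal} (hφ : MemPhi φ) :
    ConvexOn ℝ {t | φ t ≠ ⊤} (fun t => (φ t).toReal) := by
  have coe : ∀ t, φ t ≠ ⊤ → ((φ t).toReal : EReal) = φ t := fun t ht =>
    EReal.coe_toReal ht (hφ.ne_bot t)
  have key : ∀ x, φ x ≠ ⊤ → ∀ y, φ y ≠ ⊤ → ∀ a b : ℝ, 0 ≤ a → 0 ≤ b → a + b = 1 →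
      φ (a * x + b * y) ≤ ((a * (φ x).toReal + b * (φ y).toReal : ℝ) : EReal) := by
    intro x hx y hy a b ha hb hab
    have h := hφ.convex (x := (x, (φ x).toReal)) (by simp [coe x hx])
      (y := (y, (φ y).toReal)) (by simp [coe y hy]) ha hb hab
    simpa using h
  refine ⟨?_, ?_⟩
  · intro x hx y hy a b ha hb hab
    have h := key x hx y hy a b ha hb hab
    exact ne_top_of_le_ne_top (EReal.coe_ne_top _) h
  · intro x hx y hy a b ha hb hab
    have h := key x hx y hy a b ha hb hab
    have h2 := EReal.toReal_le_toReal h (hφ.ne_bot _) (EReal.coe_ne_top _)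
    rw [EReal.toReal_coe] at h2
    simpa using h2

theorem MemPhi.tStar_mem_and_map_eq_zero {φ : ℝ → EReal} (hφ : MemPhi φ) :
    tStar φ ∈ Set.Icc (0 : ℝ) 1 ∧ φ (tStar φ) = 0 := by
  obtain ⟨t, ht, ht0, hmin⟩ := hφ.exists_min
  have hle : ∀ s ∈ Set.Icc (0 : ℝ) 1, φ t ≤ φ s := by
    intro s hs
    by_cases h : s = t
    · rw [h]
    · exact (hmin s hs h).le
  have : {t | t ∈ Set.Icc (0 : ℝ) 1 ∧ ∀ s ∈ Set.Icc (0 : ℝ) 1, φ t ≤ φ s} = {t} := by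
    ext s
    simp only [Set.mem_ofPred_eq, Set.mem_singleton_iff]
    constructor
    · rintro ⟨hs, hs'⟩
      by_contra hne
      exact absurd (hs' t ht) (not_le.2 (hmin s hs hne))
    · rintro rfl
      exact ⟨ht, hle⟩
  have hts : tStar φ = t := by rw [tStar, this, csInf_singleton]
  rw [hts]
  exact ⟨ht, ht0⟩

theorem MemPhi.tStar_nonneg {φ : ℝ → EReal} (hφ : MemPhi φ) : 0 ≤ tStar φ :=
  hφ.tStar_mem_and_map_eq_zero.1.1

theorem MemPhi.tStar_lt_one {φ : ℝ → EReal} (hφ : MemPhi φ) : tStar φ < 1 := by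
  obtain ⟨h, h0⟩ := hφ.tStar_mem_and_map_eq_zero
  refine lt_of_le_of_ne h.2 fun h1 => ?_
  rw [h1, hφ.map_one] at h0
  exact one_ne_zero h0

theorem MemPhi.ne_top {φ : ℝ → EReal} (hφ : MemPhi φ) {t : ℝ} (ht : t ∈ Set.Icc (0 : ℝ) 1) :
    φ t ≠ ⊤ := interior_subset (hφ.dom ht)

theorem MemPhi.slope_le_leftDerivOne {φ : ℝ → EReal} (hφ : MemPhi φ) {v : ℝ}
    (h0 : 0 ≤ v) (h1 : v < 1) : (1 - (φ v).toReal) / (1 - v) ≤ leftDerivOne φ := by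
  have h := hφ.convexOn_toReal.slope_le_leftDeriv_of_mem_interior
    (x := v) (y := 1) (hφ.ne_top ⟨h0, h1.le⟩) (hφ.dom ⟨zero_le_one, le_rfl⟩) h1
  rw [slope_def_field] at h
  simpa [hφ.map_one, leftDerivOne] using h

theorem MemPhi.inv_le_leftDerivOne {φ : ℝ → EReal} (hφ : MemPhi φ) :
    1 / (1 - tStar φ) ≤ leftDerivOne φ := by
  have h := hφ.slope_le_leftDerivOne hφ.tStar_nonneg hφ.tStar_lt_one
  simpa [hφ.tStar_mem_and_map_eq_zero.2] using h

/-- A point of `(t_φ^*, 1)` with the slope of the chord from `t_φ^*` to `1` as a subgradient. -/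
theorem MemPhi.exists_isSubgradient {φ : ℝ → EReal} (hφ : MemPhi φ) :
    ∃ t ∈ Set.Ico (tStar φ) 1, IsSubgradient φ t (1 / (1 - tStar φ)) := by
  set a := tStar φ with ha
  have ha0 : 0 ≤ a := hφ.tStar_nonneg
  have ha1 : a < 1 := hφ.tStar_lt_one
  have h1a : 0 < 1 - a := by linarith
  set D : Set ℝ := {t | φ t ≠ ⊤} with hD
  -- Subtracting the chord from t_φ^* to 1 leaves a convex function vanishing at both ends; the
  -- desired subgradient at t says that t minimizes it.
  set g : ℝ → ℝ := fun t => (φ t).toReal - 1 / (1 - a) * (t - a) with hg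
  have hconv : ConvexOn ℝ D g := by
    refine hφ.convexOn_toReal.sub ⟨hφ.convexOn_toReal.1, ?_⟩
    intro x _ y _ s t _ _ hst
    simp only [smul_eq_mul]
    refine le_of_eq ?_
    obtain rfl : t = 1 - s := by linarith
    ring
  have hsub : Set.Icc a 1 ⊆ Set.Icc 0 1 := Set.Icc_subset_Icc_left ha0
  have hcont : ContinuousOn g (Set.Icc a 1) :=
    hconv.continuousOn_interior.mono (hsub.trans hφ.dom)
  have hga : g a = 0 := by simp [hg, ha, hφ.tStar_mem_and_map_eq_zero.2]
  have hg1 : g 1 = 0 := by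
    simp only [hg, hφ.map_one]
    field_simp
    simp
  obtain ⟨t₀, ht₀, hmin⟩ := isCompact_Icc.exists_isMinOn (Set.nonempty_Icc.2 ha1.le) hcont
  have hmid : g ((a + 1) / 2) ≤ 0 := by
    have h := hconv.2 (show a ∈ D from hφ.ne_top (hsub ⟨le_rfl, ha1.le⟩))
      (show (1 : ℝ) ∈ D from hφ.ne_top ⟨zero_le_one, le_rfl⟩)
      (show (0 : ℝ) ≤ 1 / 2 by norm_num) (show (0 : ℝ) ≤ 1 / 2 by norm_num) (by norm_num)
    simp only [hga, hg1, smul_eq_mul, mul_zero, add_zero] at h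
    rwa [show 1 / 2 * a + 1 / 2 * 1 = (a + 1) / 2 by ring] at h
  -- An interior minimizer is needed to pass from [a, 1] to the whole domain. If the minimum is 0,
  -- the midpoint attains it; otherwise the minimizer is not an endpoint.
  have hex : ∃ t ∈ Set.Ioo a 1, IsMinOn g (Set.Icc a 1) t := by
    by_cases hend : g t₀ = 0
    · refine ⟨(a + 1) / 2, ⟨by linarith, by linarith⟩, fun s hs => ?_⟩
      have := hmin hs
      simp only [Set.mem_ofPred_eq] at this ⊢
      linarith
    · refine ⟨t₀, ⟨lt_of_le_of_ne ht₀.1 ?_, lt_of_le_of_ne ht₀.2 ?_⟩, hmin⟩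
      · intro h; exact hend (h ▸ hga)
      · intro h; exact hend (h ▸ hg1)
  obtain ⟨t, ht, htmin⟩ := hex
  have htD : t ∈ D := hφ.ne_top ⟨by linarith [ht.1], ht.2.le⟩
  have hloc : IsLocalMinOn g D t :=
    ((htmin.isLocalMin (Icc_mem_nhds ht.1 ht.2))).on D
  have hglob := IsMinOn.of_isLocalMinOn_of_convexOn htD hloc hconv
  refine ⟨t, ⟨ht.1.le, ht.2⟩, fun y => ?_⟩
  by_cases hy : φ y = ⊤
  · rw [hy]; exact le_top
  · have h := hglob (show y ∈ D from hy)
    simp only [Set.mem_ofPred_eq, hg] at h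
    rw [← EReal.coe_toReal hy (hφ.ne_bot y), ← EReal.coe_toReal htD (hφ.ne_bot t)]
    norm_cast
    linarith

theorem MemPhi.tStar_le_tBar {φ : ℝ → EReal} (hφ : MemPhi φ) : tStar φ ≤ tBar φ :=
  le_csInf hφ.exists_isSubgradient fun _ h => h.1.1

theorem MemPhi.tBar_lt_one {φ : ℝ → EReal} (hφ : MemPhi φ) : tBar φ < 1 := by
  obtain ⟨t, ht, hsub⟩ := hφ.exists_isSubgradient
  exact lt_of_le_of_lt (csInf_le ⟨tStar φ, fun _ h => h.1.1⟩ ⟨ht, hsub⟩) ht.2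

/-- A minimizer of `φ v - s v` over `[0,1]` with small `s` is at most `t̄_φ`. -/
theorem MemPhi.le_tBar_of_minimizer {φ : ℝ → EReal} (hφ : MemPhi φ) {s w : ℝ}
    (hw : w ∈ Set.Icc (0 : ℝ) 1)
    (hmin : ∀ v ∈ Set.Icc (0 : ℝ) 1, (φ w).toReal - s * w ≤ (φ v).toReal - s * v)
    (hs : s < 1 / (1 - tStar φ)) : w ≤ tBar φ := by
  -- Comparing with every candidate t avoids showing that the infimum is attained.
  refine le_csInf hφ.exists_isSubgradient fun t ht => ?_
  by_contra! hlt
  have ht0 : t ∈ Set.Icc (0 : ℝ) 1 := ⟨hφ.tStar_nonneg.trans ht.1.1, ht.1.2.le⟩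
  have h := ht.2 w
  rw [← EReal.coe_toReal (hφ.ne_top hw) (hφ.ne_bot w),
    ← EReal.coe_toReal (hφ.ne_top ht0) (hφ.ne_bot t)] at h
  norm_cast at h
  have h2 := hmin t ht0
  nlinarith [mul_pos (sub_pos.2 hs) (sub_pos.2 hlt)]

/-- A minimizer of `φ v - s v` over `[0,1]` with large `s` is `1`. -/
theorem MemPhi.le_leftDerivOne_of_minimizer {φ : ℝ → EReal} (hφ : MemPhi φ) {s w : ℝ}
    (hw : w ∈ Set.Icc (0 : ℝ) 1)
    (hmin : ∀ v ∈ Set.Icc (0 : ℝ) 1, (φ w).toReal - s * w ≤ (φ v).toReal - s * v)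
    (hw1 : w < 1) : s ≤ leftDerivOne φ := by
  refine le_trans ?_ (hφ.slope_le_leftDerivOne hw.1 hw1)
  rw [le_div_iff₀ (by linarith)]
  have h := hmin 1 ⟨zero_le_one, le_rfl⟩
  rw [hφ.map_one] at h
  simp only [EReal.toReal_one] at h
  linarith

/-! ### Group norms -/

theorem gnorm_nonneg (grp : Fin p → Fin m) (x : Fin p → ℝ) (i : Fin m) : 0 ≤ gnorm grp x i :=
  Real.sqrt_nonneg _

theorem gnorm_sq (grp : Fin p → Fin m) (x : Fin p → ℝ) (i : Fin m) :
    gnorm grp x i ^ 2 = ∑ j ∈ Finset.univ.filter (fun j => grp j = i), x j ^ 2 :=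
  Real.sq_sqrt (Finset.sum_nonneg fun _ _ => sq_nonneg _)

theorem sum_gnorm_sq (grp : Fin p → Fin m) (x : Fin p → ℝ) :
    ∑ i, gnorm grp x i ^ 2 = ∑ j, x j ^ 2 := by
  simp_rw [gnorm_sq]
  exact Finset.sum_fiberwise _ _ _

theorem sum_eq_sum_groups (grp : Fin p → Fin m) (f : Fin p → ℝ) :
    ∑ j, f j = ∑ i, ∑ j ∈ Finset.univ.filter (fun j => grp j = i), f j :=
  (Finset.sum_fiberwise _ _ _).symm

theorem gnorm_eq_norm (grp : Fin p → Fin m) (x : Fin p → ℝ) (i : Fin m) :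
    gnorm grp x i =
      ‖(WithLp.toLp 2 (fun j => if grp j = i then x j else 0) : EuclideanSpace ℝ (Fin p))‖ := by
  rw [EuclideanSpace.norm_eq, gnorm, Finset.sum_filter]
  congr 1
  refine Finset.sum_congr rfl fun j _ => ?_
  split_ifs <;> simp [*]

theorem gnorm_le_add (grp : Fin p → Fin m) (x y : Fin p → ℝ) (i : Fin m) :
    gnorm grp x i ≤ gnorm grp y i + gnorm grp (x - y) i := by
  rw [gnorm_eq_norm, gnorm_eq_norm, gnorm_eq_norm]
  refine le_of_eq_of_le ?_ (norm_add_le _ _)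
  congr 1
  ext j
  simp only [PiLp.add_apply]
  split_ifs <;> simp

theorem gnorm_sub_comm (grp : Fin p → Fin m) (x y : Fin p → ℝ) (i : Fin m) :
    gnorm grp (x - y) i = gnorm grp (y - x) i := by
  unfold gnorm
  congr 1
  refine Finset.sum_congr rfl fun j _ => ?_
  simp only [Pi.sub_apply]
  ring

theorem gnorm_eq_zero_iff (grp : Fin p → Fin m) (x : Fin p → ℝ) (i : Fin m) :
    gnorm grp x i = 0 ↔ ∀ j, grp j = i → x j = 0 := by
  rw [gnorm, Real.sqrt_eq_zero (Finset.sum_nonneg fun _ _ => sq_nonneg _),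
    Finset.sum_eq_zero_iff_of_nonneg fun _ _ => sq_nonneg _]
  simp

theorem mem_groupSupport (grp : Fin p → Fin m) (x : Fin p → ℝ) (i : Fin m) :
    i ∈ groupSupport grp x ↔ gnorm grp x i ≠ 0 := by
  simp [groupSupport]

theorem gnorm_eq_zero_of_notMem {grp : Fin p → Fin m} {x : Fin p → ℝ} {S : Finset (Fin m)}
    (h : groupSupport grp x ⊆ S) {i : Fin m} (hi : i ∉ S) : gnorm grp x i = 0 := by
  by_contra hne
  exact hi (h ((mem_groupSupport grp x i).2 hne))

theorem groupSupport_subset_iff {grp : Fin p → Fin m} {x : Fin p → ℝ} {S : Finset (Fin m)} :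
    groupSupport grp x ⊆ S ↔ ∀ j, grp j ∉ S → x j = 0 := by
  constructor
  · intro h j hj
    exact (gnorm_eq_zero_iff grp x _).1 (gnorm_eq_zero_of_notMem h hj) j rfl
  · intro h i hi
    by_contra hiS
    refine (mem_groupSupport grp x i).1 hi ((gnorm_eq_zero_iff grp x i).2 ?_)
    rintro j rfl
    exact h j hiS

theorem groupSupport_nonempty {grp : Fin p → Fin m} {x : Fin p → ℝ} (hx : x ≠ 0) :
    (groupSupport grp x).Nonempty := by
  obtain ⟨j, hj⟩ := Function.ne_iff.1 hx
  refine ⟨grp j, (mem_groupSupport grp x _).2 fun h => hj ?_⟩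
  exact (gnorm_eq_zero_iff grp x _).1 h j rfl

theorem minGroupNorm_pos {grp : Fin p → Fin m} {x : Fin p → ℝ} (hx : x ≠ 0) :
    0 < minGroupNorm grp x := by
  have hne : (gnorm grp x '' (groupSupport grp x : Set (Fin m))).Nonempty :=
    (groupSupport_nonempty hx).to_set.image _
  obtain ⟨i, hi, h⟩ := hne.csInf_mem ((Finset.finite_toSet _).image _)
  rw [minGroupNorm, ← h]
  exact lt_of_le_of_ne (gnorm_nonneg _ _ _) (Ne.symm ((mem_groupSupport grp x i).1 hi))

theorem minGroupNorm_le {grp : Fin p → Fin m} {x : Fin p → ℝ} {i : Fin m}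
    (hi : i ∈ groupSupport grp x) : minGroupNorm grp x ≤ gnorm grp x i :=
  csInf_le ((Finset.finite_toSet _).image _).bddBelow ⟨i, hi, rfl⟩

theorem abs_group_inner_le (grp : Fin p → Fin m) (g d : Fin p → ℝ) (i : Fin m) :
    |∑ j ∈ Finset.univ.filter (fun j => grp j = i), g j * d j| ≤ gnorm grp g i * gnorm grp d i := by
  refine abs_le_of_sq_le_sq ?_ (mul_nonneg (gnorm_nonneg _ _ _) (gnorm_nonneg _ _ _))
  rw [mul_pow, gnorm_sq, gnorm_sq]
  exact Finset.sum_mul_sq_le_sq_mul_sq _ _ _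

theorem groupSize_le_max (grp : Fin p → Fin m) (i : Fin m) : groupSize grp i ≤ maxGroupSize grp :=
  Finset.le_sup (Finset.mem_univ i)

theorem gnorm_le_of_abs_le {grp : Fin p → Fin m} {x : Fin p → ℝ} {i : Fin m} {τ : ℝ} (hτ : 0 ≤ τ)
    (h : ∀ j, grp j = i → |x j| ≤ τ) : gnorm grp x i ≤ √(maxGroupSize grp) * τ := by
  refine abs_le_of_sq_le_sq' ?_ (by positivity) |>.2
  rw [gnorm_sq, mul_pow, Real.sq_sqrt (by positivity)]
  calc _ ≤ ∑ j ∈ Finset.univ.filter (fun j => grp j = i), τ ^ 2 :=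
        Finset.sum_le_sum fun j hj => sq_le_sq' (abs_le.1 (h j (by simpa using hj))).1
          (abs_le.1 (h j (by simpa using hj))).2
    _ = groupSize grp i * τ ^ 2 := by simp [groupSize]
    _ ≤ _ := by
        gcongr
        exact groupSize_le_max grp i

theorem sum_abs_group_le (grp : Fin p → Fin m) (x : Fin p → ℝ) (i : Fin m) :
    ∑ j ∈ Finset.univ.filter (fun j => grp j = i), |x j| ≤ √(maxGroupSize grp) * gnorm grp x i := by
  refine abs_le_of_sq_le_sq' ?_ (mul_nonneg (Real.sqrt_nonneg _) (gnorm_nonneg _ _ _)) |>.2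
  rw [mul_pow, Real.sq_sqrt (by positivity), gnorm_sq]
  refine sq_sum_le_card_mul_sum_sq.trans ?_
  simp_rw [sq_abs]
  gcongr
  exact groupSize_le_max grp i

/-- Cauchy–Schwarz for a weighted sum of group norms. -/
theorem sq_sum_mul_gnorm_le (grp : Fin p → Fin m) (x : Fin p → ℝ) (T : Finset (Fin m))
    (c : Fin m → ℝ) :
    (∑ i ∈ T, c i * gnorm grp x i) ^ 2 ≤ (∑ i ∈ T, c i ^ 2) * ∑ j, x j ^ 2 := by
  refine (Finset.sum_mul_sq_le_sq_mul_sq _ _ _).trans ?_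
  refine mul_le_mul_of_nonneg_left ?_ (Finset.sum_nonneg fun _ _ => sq_nonneg _)
  rw [← sum_gnorm_sq grp]
  exact Finset.sum_le_univ_sum_of_nonneg fun _ => sq_nonneg _

/-! ### The least squares loss -/

/-- The gradient of the least squares loss. -/
def lossGrad (A : Matrix (Fin n) (Fin p) ℝ) (b : Fin n → ℝ) (x : Fin p → ℝ) (j : Fin p) : ℝ :=
  1 / (n : ℝ) * ∑ r, A r j * ((A.mulVec x) r - b r)

theorem sum_lossGrad_mul (A : Matrix (Fin n) (Fin p) ℝ) (b : Fin n → ℝ) (x d : Fin p → ℝ) :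
    ∑ j, lossGrad A b x j * d j = 1 / (n : ℝ) * ∑ r, (A.mulVec d) r * ((A.mulVec x) r - b r) := by
  simp only [lossGrad, Matrix.mulVec, dotProduct, Finset.mul_sum, Finset.sum_mul]
  rw [Finset.sum_comm]
  refine Finset.sum_congr rfl fun r _ => Finset.sum_congr rfl fun j _ => ?_
  ring

theorem loss_add (A : Matrix (Fin n) (Fin p) ℝ) (b : Fin n → ℝ) (x d : Fin p → ℝ) :
    loss A b (x + d) = loss A b x + ∑ j, lossGrad A b x j * d j +
      1 / (2 * (n : ℝ)) * ∑ r, (A.mulVec d) r ^ 2 := by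
  rw [sum_lossGrad_mul, loss, loss, Matrix.mulVec_add,
    show (1 : ℝ) / n = 1 / (2 * n) * 2 by rw [one_div, one_div, mul_inv]; ring,
    mul_assoc, ← mul_add, ← mul_add]
  congr 1
  rw [Finset.mul_sum, ← Finset.sum_add_distrib, ← Finset.sum_add_distrib]
  refine Finset.sum_congr rfl fun r _ => ?_
  simp only [Pi.add_apply]
  ring

/-- The gradient at an oracle least squares solution is orthogonal to the oracle subspace. -/
theorem IsOracleLS.sum_lossGrad_mul_eq_zero {grp : Fin p → Fin m} {A : Matrix (Fin n) (Fin p) ℝ}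
    {b : Fin n → ℝ} {S : Finset (Fin m)} {x : Fin p → ℝ} (h : IsOracleLS grp A b S x)
    {d : Fin p → ℝ} (hd : groupSupport grp d ⊆ S) : ∑ j, lossGrad A b x j * d j = 0 := by
  set G := ∑ j, lossGrad A b x j * d j with hG
  set q := 1 / (2 * (n : ℝ)) * ∑ r, (A.mulVec d) r ^ 2 with hq
  have key : ∀ t : ℝ, 0 ≤ t * G + t ^ 2 * q := by
    intro t
    have hs : groupSupport grp (x + t • d) ⊆ S := by
      rw [groupSupport_subset_iff] at hd ⊢
      intro j hj
      simp [hd j hj, groupSupport_subset_iff.1 h.1 j hj]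
    have h1 := h.2 _ hs
    rw [loss_add, Matrix.mulVec_smul] at h1
    have e1 : ∑ j, lossGrad A b x j * (t • d) j = t * G := by
      rw [hG, Finset.mul_sum]
      refine Finset.sum_congr rfl fun j _ => ?_
      simp only [Pi.smul_apply, smul_eq_mul]; ring
    have e2 : 1 / (2 * (n : ℝ)) * ∑ r : Fin n, (t • A.mulVec d) r ^ 2 = t ^ 2 * q := by
      have : ∑ r : Fin n, (t • A.mulVec d) r ^ 2 = t ^ 2 * ∑ r, (A.mulVec d) r ^ 2 := by
        simp only [Pi.smul_apply, smul_eq_mul, mul_pow, Finset.mul_sum]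
      rw [hq, this]
      ring
    rw [e1, e2] at h1
    linarith
  have hq0 : 0 ≤ q := by positivity
  by_contra hne
  -- The exact minimizer would be -G / (2q); q + 1 stays positive when q = 0 and still makes the
  -- value negative.
  have h2 := key (-G / (q + 1))
  have h3 : -G / (q + 1) * G + (-G / (q + 1)) ^ 2 * q = -(G ^ 2 / (q + 1) ^ 2) := by
    field_simp
    ring
  rw [h3] at h2
  have : 0 < G ^ 2 / (q + 1) ^ 2 := by positivity
  linarith

theorem IsOracleLS.lossGrad_eq_zero {grp : Fin p → Fin m} {A : Matrix (Fin n) (Fin p) ℝ}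
    {b : Fin n → ℝ} {S : Finset (Fin m)} {x : Fin p → ℝ} (h : IsOracleLS grp A b S x)
    {j : Fin p} (hj : grp j ∈ S) : lossGrad A b x j = 0 := by
  have := h.sum_lossGrad_mul_eq_zero (d := Pi.single j 1) (groupSupport_subset_iff.2 fun k hk => by
    have : k ≠ j := by rintro rfl; exact hk hj
    simp [this])
  simpa [Pi.single_apply] using this

/-! ### One step of the multi-stage relaxation -/

theorem gnorm_sub_eq {grp : Fin p → Fin m} {x y : Fin p → ℝ} {i : Fin m}
    (h : gnorm grp y i = 0) : gnorm grp (x - y) i = gnorm grp x i := by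
  unfold gnorm
  congr 1
  refine Finset.sum_congr rfl fun j hj => ?_
  simp [(gnorm_eq_zero_iff grp y i).1 h j (by simpa using hj)]

/-- The loss is quadratic, so its expansion at `y` is exact, and `x` does at least as well as `y`.
On `S` the gradient vanishes and the penalty gains at most the group norm of the difference. Off `S`
the vector `y` vanishes, so the penalty is paid in full while the gradient gains at most `K` per
unit. -/
theorem weighted_step_bound {grp : Fin p → Fin m} {A : Matrix (Fin n) (Fin p) ℝ} {b : Fin n → ℝ}
    {S : Finset (Fin m)} {x y : Fin p → ℝ} {lam K : ℝ} {w : Fin m → ℝ}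
    (hy : groupSupport grp y ⊆ S) (hw : ∀ i, w i ≤ 1) (hlam : 0 ≤ lam)
    (hmin : loss A b x + lam * ∑ i, (1 - w i) * gnorm grp x i
      ≤ loss A b y + lam * ∑ i, (1 - w i) * gnorm grp y i)
    (hg0 : ∀ j, grp j ∈ S → lossGrad A b y j = 0)
    (hgK : ∀ i, i ∉ S → gnorm grp (lossGrad A b y) i ≤ K) :
    1 / (2 * (n : ℝ)) * ∑ r, (A.mulVec (x - y)) r ^ 2 ≤
      ∑ i ∈ S, lam * (1 - w i) * gnorm grp (x - y) i +
        ∑ i ∈ Sᶜ, (K - lam * (1 - w i)) * gnorm grp (x - y) i := by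
  have hexp := loss_add A b y (x - y)
  rw [add_sub_cancel, sum_eq_sum_groups grp] at hexp
  set G : Fin m → ℝ := fun i =>
    ∑ j ∈ Finset.univ.filter (fun j => grp j = i), lossGrad A b y j * (x - y) j with hG
  have hGS : ∀ i ∈ S, G i = 0 := fun i hi => Finset.sum_eq_zero fun j hj => by
    rw [hg0 j (by simpa [(Finset.mem_filter.1 hj).2] using hi), zero_mul]
  have hGK : ∀ i, i ∉ S → -(K * gnorm grp (x - y) i) ≤ G i := fun i hi => by
    have h1 := (abs_le.1 (abs_group_inner_le grp (lossGrad A b y) (x - y) i)).1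
    have h2 := mul_le_mul_of_nonneg_right (hgK i hi) (gnorm_nonneg grp (x - y) i)
    linarith
  have h1 : 1 / (2 * (n : ℝ)) * ∑ r, (A.mulVec (x - y)) r ^ 2 ≤
      ∑ i, (lam * (1 - w i) * (gnorm grp y i - gnorm grp x i) - G i) := by
    have : ∑ i, (lam * (1 - w i) * (gnorm grp y i - gnorm grp x i) - G i) =
        lam * ∑ i, (1 - w i) * gnorm grp y i - lam * ∑ i, (1 - w i) * gnorm grp x i
          - ∑ i, G i := by
      rw [Finset.mul_sum, Finset.mul_sum, ← Finset.sum_sub_distrib, ← Finset.sum_sub_distrib]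
      refine Finset.sum_congr rfl fun i _ => ?_
      ring
    rw [this]
    linarith
  refine h1.trans ?_
  rw [← Finset.sum_add_sum_compl S]
  refine add_le_add (Finset.sum_le_sum fun i hi => ?_) (Finset.sum_le_sum fun i hi => ?_)
  · rw [hGS i hi, sub_zero]
    have h2 := gnorm_le_add grp y x i
    rw [gnorm_sub_comm] at h2
    exact mul_le_mul_of_nonneg_left (by linarith) (mul_nonneg hlam (by linarith [hw i]))
  · rw [Finset.mem_compl] at hi
    have h0 := gnorm_eq_zero_of_notMem hy hi
    have h3 := hGK i hi
    rw [gnorm_sub_eq h0] at h3 ⊢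
    rw [h0]
    linarith

/-- The error after one convex stage is controlled by the number of groups with a wrong weight. -/
theorem stage_error_le {grp : Fin p → Fin m} {A : Matrix (Fin n) (Fin p) ℝ} {b : Fin n → ℝ}
    {S : Finset (Fin m)} {x y : Fin p → ℝ} {lam K tb κ l : ℝ} {w : Fin m → ℝ}
    (hκ : 0 < κ) (htb0 : 0 ≤ tb) (htb1 : tb < 1) (hRSC : RSC A κ (cone tb grp S l))
    (hy : groupSupport grp y ⊆ S) (hw : ∀ i, w i ∈ Set.Icc (0 : ℝ) 1) (hlam : 0 < lam)
    (hK0 : 0 ≤ K) (hK : 2 * K ≤ lam * (1 - tb))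
    (hmin : loss A b x + lam * ∑ i, (1 - w i) * gnorm grp x i
      ≤ loss A b y + lam * ∑ i, (1 - w i) * gnorm grp y i)
    (hg0 : ∀ j, grp j ∈ S → lossGrad A b y j = 0)
    (hgK : ∀ i, i ∉ S → gnorm grp (lossGrad A b y) i ≤ K)
    (hcard : (S.card : ℝ) + (Sᶜ.filter (fun i => tb < w i)).card ≤ l) :
    κ ^ 2 * ∑ j, (x - y) j ^ 2 ≤
      lam ^ 2 * (S.filter (fun i => w i < 1)).card +
        K ^ 2 * (Sᶜ.filter (fun i => tb < w i)).card := by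
  set N : Finset (Fin m) := Sᶜ.filter (fun i => tb < w i) with hN
  have hstep := weighted_step_bound hy (fun i => (hw i).2) hlam.le hmin hg0 hgK
  set d : Fin m → ℝ := gnorm grp (x - y) with hd
  have hd0 : ∀ i, 0 ≤ d i := gnorm_nonneg grp (x - y)
  set q := 1 / (2 * (n : ℝ)) * ∑ r, (A.mulVec (x - y)) r ^ 2 with hq
  have hq0 : 0 ≤ q := by positivity
  have hdisj : Disjoint S N :=
    Finset.disjoint_left.2 fun i hi hi' => Finset.mem_compl.1 (Finset.mem_filter.1 hi').1 hi
  have hcompl : (S ∪ N)ᶜ = Sᶜ.filter (fun i => ¬ tb < w i) := by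
    ext i
    simp only [hN, Finset.mem_compl, Finset.mem_union, Finset.mem_filter, not_or, not_and]
    tauto
  have hsplit : ∀ f : Fin m → ℝ, ∑ i ∈ Sᶜ, f i = ∑ i ∈ N, f i + ∑ i ∈ (S ∪ N)ᶜ, f i := by
    intro f
    rw [hcompl, hN, Finset.sum_filter_add_sum_filter_not]
  -- Where w i ≤ tb the penalty is at least lam (1 - tb) ≥ 2 K, so half of it survives the gradient.
  have hfar : ∑ i ∈ (S ∪ N)ᶜ, (K - lam * (1 - w i)) * d i ≤
      -(lam * (1 - tb) / 2) * ∑ i ∈ (S ∪ N)ᶜ, d i := by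
    rw [Finset.mul_sum]
    refine Finset.sum_le_sum fun i hi => mul_le_mul_of_nonneg_right ?_ (hd0 i)
    rw [hcompl, Finset.mem_filter, not_lt] at hi
    nlinarith [mul_le_mul_of_nonneg_left hi.2 hlam.le]
  have hnear : ∑ i ∈ N, (K - lam * (1 - w i)) * d i ≤ ∑ i ∈ N, K * d i :=
    Finset.sum_le_sum fun i _ => mul_le_mul_of_nonneg_right
      (by nlinarith [mul_nonneg hlam.le (sub_nonneg.2 (hw i).2)]) (hd0 i)
  have hS : ∑ i ∈ S, lam * (1 - w i) * d i ≤ ∑ i ∈ S.filter (fun i => w i < 1), lam * d i := by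
    rw [Finset.sum_filter]
    refine Finset.sum_le_sum fun i _ => ?_
    split_ifs with h
    · refine mul_le_mul_of_nonneg_right ?_ (hd0 i)
      nlinarith [(hw i).1]
    · rw [le_antisymm (hw i).2 (not_lt.1 h)]
      simp
  rw [hsplit] at hstep
  have hfar0 : 0 ≤ lam * (1 - tb) / 2 * ∑ i ∈ (S ∪ N)ᶜ, d i :=
    mul_nonneg (by nlinarith) (Finset.sum_nonneg fun i _ => hd0 i)
  -- The left side of `hstep` is nonnegative, so the far groups are dominated by those of S ∪ N,
  -- where each coefficient is at most lam; dividing by lam (1 - tb) / 2 gives the cone constant.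
  have hcone : x - y ∈ cone tb grp S l := by
    refine ⟨S ∪ N, Finset.subset_union_left, ?_, ?_⟩
    · rw [Finset.card_union_of_disjoint hdisj]
      push_cast
      exact hcard
    · have h1 : ∑ i ∈ S.filter (fun i => w i < 1), lam * d i ≤ lam * ∑ i ∈ S, d i := by
        rw [Finset.mul_sum]
        exact Finset.sum_le_sum_of_subset_of_nonneg (Finset.filter_subset _ _)
          fun i _ _ => mul_nonneg hlam.le (hd0 i)
      have h2 : ∑ i ∈ N, K * d i ≤ lam * ∑ i ∈ N, d i := by
        rw [Finset.mul_sum]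
        refine Finset.sum_le_sum fun i _ => mul_le_mul_of_nonneg_right ?_ (hd0 i)
        nlinarith
      rw [Finset.sum_union hdisj, div_mul_eq_mul_div, le_div_iff₀ (by linarith)]
      refine le_of_mul_le_mul_left ?_ (half_pos hlam)
      linarith
  have hE : κ * ∑ j, (x - y) j ^ 2 ≤
      ∑ i ∈ S.filter (fun i => w i < 1), lam * d i + ∑ i ∈ N, K * d i := by
    have := hRSC _ hcone
    linarith
  set E := ∑ j, (x - y) j ^ 2 with hEdef
  have hE0 : 0 ≤ E := Finset.sum_nonneg fun _ _ => sq_nonneg _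
  have hdisj' : Disjoint (S.filter (fun i => w i < 1)) N :=
    hdisj.mono_left (Finset.filter_subset _ _)
  have hCS := sq_sum_mul_gnorm_le grp (x - y) (S.filter (fun i => w i < 1) ∪ N)
    (fun i => if i ∈ S then lam else K)
  have hval : ∀ f : ℝ → Fin m → ℝ,
      ∑ i ∈ S.filter (fun i => w i < 1) ∪ N, f (if i ∈ S then lam else K) i =
      ∑ i ∈ S.filter (fun i => w i < 1), f lam i + ∑ i ∈ N, f K i := by
    intro f
    rw [Finset.sum_union hdisj']
    congr 1
    · refine Finset.sum_congr rfl fun i hi => ?_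
      rw [if_pos (Finset.mem_filter.1 hi).1]
    · refine Finset.sum_congr rfl fun i hi => ?_
      rw [if_neg (Finset.mem_compl.1 (Finset.mem_filter.1 hi).1)]
  rw [hval (fun c i => c * gnorm grp (x - y) i), hval (fun c _ => c ^ 2)] at hCS
  simp only [Finset.sum_const, nsmul_eq_mul] at hCS
  have h4 : (κ * E) ^ 2 ≤ ((S.filter (fun i => w i < 1)).card * lam ^ 2 + N.card * K ^ 2) * E :=
    (pow_le_pow_left₀ (by positivity) hE 2).trans hCS
  rcases hE0.eq_or_lt with h | h
  · rw [← h, mul_zero]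
    positivity
  · refine le_of_mul_le_mul_right ?_ h
    linarith

/-- Groups with a wrong weight contribute to the error of the preceding stage. -/
theorem card_wrong_le {grp : Fin p → Fin m} {S : Finset (Fin m)} {x y : Fin p → ℝ}
    {tb s a : ℝ} {w : Fin m → ℝ} (hs : 0 ≤ s) (ha0 : 0 ≤ a)
    (hy : groupSupport grp y ⊆ S)
    (hN : ∀ i, i ∉ S → tb < w i → 1 ≤ s * gnorm grp x i)
    (hS : ∀ i ∈ S, w i < 1 → a ≤ s * (gnorm grp y i - gnorm grp x i)) :
    a ^ 2 * (S.filter (fun i => w i < 1)).card + (Sᶜ.filter (fun i => tb < w i)).card ≤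
      s ^ 2 * ∑ j, (x - y) j ^ 2 := by
  have h1 : a ^ 2 * (S.filter (fun i => w i < 1)).card ≤
      ∑ i ∈ S, s ^ 2 * gnorm grp (x - y) i ^ 2 := by
    rw [mul_comm, ← nsmul_eq_mul, ← Finset.sum_const, Finset.sum_filter]
    refine Finset.sum_le_sum fun i hi => ?_
    split_ifs with h
    · rw [← mul_pow]
      refine pow_le_pow_left₀ ha0 ((hS i hi h).trans ?_) 2
      have h2 := gnorm_le_add grp y x i
      rw [gnorm_sub_comm] at h2
      exact mul_le_mul_of_nonneg_left (by linarith) hs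
    · positivity
  have h2 : ((Sᶜ.filter (fun i => tb < w i)).card : ℝ) ≤
      ∑ i ∈ Sᶜ, s ^ 2 * gnorm grp (x - y) i ^ 2 := by
    rw [← mul_one (Finset.card _ : ℝ), ← nsmul_eq_mul, ← Finset.sum_const, Finset.sum_filter]
    refine Finset.sum_le_sum fun i hi => ?_
    rw [Finset.mem_compl] at hi
    split_ifs with h
    · rw [← mul_pow, gnorm_sub_eq (gnorm_eq_zero_of_notMem hy hi)]
      exact one_le_pow₀ (hN i hi h)
    · positivity
  rw [← sum_gnorm_sq grp, Finset.mul_sum, ← Finset.sum_add_sum_compl S]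
  exact add_le_add h1 h2

/-! ### Finite convergence under bounds on the noise -/

/-- The number of stages `k̄` suffices for the geometric rate to fall below one wrong group. -/
theorem pow_mul_le_one_of_kBar_le {ts κ ν ρ : ℝ} {r k : ℕ} (hr : 0 < r)
    (hκν : 0 < 6 * ν * κ) (hnum : 0 < max 1 ρ * ρ * (1 - ts) * (1 + 3 * √5))
    (hlt : max 1 ρ * ρ * (1 - ts) * (1 + 3 * √5) < 6 * ν * κ)
    (hk : kBar ts κ ν ρ r ≤ k + 1) :
    (max 1 ρ * ρ * (1 - ts) * (1 + 3 * √5) / (6 * ν * κ)) ^ (2 * k) * r ≤ 1 := by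
  set a := max 1 ρ * ρ * (1 - ts) * (1 + 3 * √5) with ha
  set d := 6 * ν * κ with hd
  have hlog : 0 < Real.log d - Real.log a := sub_pos.2 (Real.log_lt_log hnum hlt)
  have h1 : 0.5 * Real.log (r : ℝ) / (Real.log d - Real.log a) ≤ k := by
    rw [kBar] at hk
    exact (Nat.le_ceil _).trans (by exact_mod_cast Nat.le_of_succ_le_succ hk)
  rw [div_le_iff₀ hlog] at h1
  have hr' : (0 : ℝ) < r := by exact_mod_cast hr
  have hq : 0 < a / d := div_pos hnum hκν
  rw [← Real.log_nonpos_iff (by positivity), Real.log_mul (by positivity) hr'.ne', Real.log_pow,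
    Real.log_div hnum.ne' hκν.ne']
  push_cast
  nlinarith

set_option maxHeartbeats 1000000 in
-- The deterministic core: the noise appears only through `hgK` and `hxK`. The parameter windows
-- make the composition of `stage_error_le` and `card_wrong_le` a contraction, and also keep the
-- wrong groups outside the support few enough for RSC to apply again.
theorem recovery_of_noise_bounds {φ : ℝ → EReal} (hφ : MemPhi φ) {grp : Fin p → Fin m}
    {A : Matrix (Fin n) (Fin p) ℝ} {b : Fin n → ℝ} {xbar xLS : Fin p → ℝ} {κ K R ν ρ : ℝ}
    (hx0 : xbar ≠ 0) (hκ : 0 < κ)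
    (hRSC : RSC A κ (cone (tBar φ) grp (groupSupport grp xbar)
      (1.5 * (groupSupport grp xbar).card)))
    (hK0 : 0 ≤ K)
    (hν₁ : (1 - tStar φ) * (1 + 3 * √5) / (4 * κ) < ν) (hν₂ : ν ≤ (1 - tBar φ) / (2 * K))
    (hρ₁ : max (2 * leftDerivOne φ / minGroupNorm grp xbar) (4 * K * ν / (1 - tBar φ)) < ρ)
    (hρ₂ : ρ ≤ √(4 * κ * ν / ((1 - tStar φ) * (1 + 3 * √5))))
    (hLS : IsOracleLS grp A b (groupSupport grp xbar) xLS) (hbox : xLS ∈ box p R)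
    (hgK : ∀ i, i ∉ groupSupport grp xbar → gnorm grp (lossGrad A b xLS) i ≤ K)
    (hxK : ∀ i ∈ groupSupport grp xbar, 2 * κ * gnorm grp (xbar - xLS) i ≤ K)
    {x : ℕ → Fin p → ℝ} {w : ℕ → Fin m → ℝ} (hrun : IsGEPMSCRA φ grp A b R ν ρ x w) {k : ℕ}
    (hk : kBar (tStar φ) κ ν ρ (groupSupport grp xbar).card ≤ k) (hk2 : 2 ≤ k) :
    x k = xLS ∧ groupSupport grp (x k) = groupSupport grp xbar := by
  set S := groupSupport grp xbar with hSdef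
  set h := 1 - tStar φ with hh
  set c := 1 + 3 * √5 with hc
  set tb := tBar φ with htb
  set Ld := leftDerivOne φ with hL
  have hh0 : 0 < h := sub_pos.2 hφ.tStar_lt_one
  have hh1 : h ≤ 1 := by linarith [hφ.tStar_nonneg]
  have htb1 : tb < 1 := hφ.tBar_lt_one
  have htb0 : 0 ≤ tb := hφ.tStar_nonneg.trans hφ.tStar_le_tBar
  have hc7 : 38 / 5 ≤ c := by
    have : (11 / 5 : ℝ) ≤ √5 := Real.le_sqrt_of_sq_le (by norm_num)
    linarith
  have hLh : 1 ≤ Ld * h := by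
    have := hφ.inv_le_leftDerivOne
    rwa [div_le_iff₀ hh0] at this
  have hLpos : 0 < Ld := by
    by_contra! hneg
    nlinarith
  have hr1 : 1 ≤ S.card := Finset.card_pos.2 (groupSupport_nonempty hx0)
  have hν : 0 < ν := lt_of_le_of_lt (by positivity) hν₁
  have hy : h * c < 4 * (κ * ν) := by
    rw [div_lt_iff₀ (by positivity)] at hν₁
    linarith
  -- With K = 0 the quotient in `hν₂` is 0 by convention, which contradicts ν > 0.
  have hKpos : 0 < K := by
    refine lt_of_le_of_ne hK0 ?_
    rintro rfl
    simp only [mul_zero, div_zero] at hν₂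
    linarith
  have hKν : 2 * K * ν ≤ 1 - tb := by
    rw [le_div_iff₀ (by positivity)] at hν₂
    linarith
  have hmin0 := minGroupNorm_pos (grp := grp) hx0
  have hρmin : 2 * Ld < ρ * minGroupNorm grp xbar := by
    have := (le_max_left _ _).trans_lt hρ₁
    rwa [div_lt_iff₀ hmin0] at this
  have hρK : 4 * K * ν < ρ * (1 - tb) := by
    have := (le_max_right _ _).trans_lt hρ₁
    rwa [div_lt_iff₀ (by linarith)] at this
  have hρ : 0 < ρ := by
    by_contra! hneg
    nlinarith
  have hρsq : ρ ^ 2 * (h * c) ≤ 4 * (κ * ν) := by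
    have := (Real.le_sqrt (by positivity) (by positivity)).1 hρ₂
    rw [le_div_iff₀ (by positivity)] at this
    linarith
  have hκν : 0 < κ * ν := by positivity
  -- the noise is small compared with the signal
  have hρhK : ρ * h * K ≤ κ / 5 := by
    have h1 : 4 * K * ν ≤ ρ := by nlinarith
    have h2 : ρ * h * (4 * K * ν) ≤ ρ ^ 2 * h := by
      have := mul_le_mul_of_nonneg_left h1 (by positivity : 0 ≤ ρ * h)
      linarith
    have h3 : ρ ^ 2 * h * (38 / 5) ≤ 4 * (κ * ν) := by
      refine le_trans ?_ hρsq
      rw [← mul_assoc]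
      exact mul_le_mul_of_nonneg_left hc7 (by positivity)
    refine le_of_mul_le_mul_right ?_ hν
    nlinarith
  have hsig : ∀ i ∈ S, 2 * Ld * h - 1 / 10 ≤ ρ * h * gnorm grp xLS i := by
    intro i hi
    have h1 := gnorm_le_add grp xbar xLS i
    have h2 := minGroupNorm_le hi
    have h3 : ρ * h * (2 * κ * gnorm grp (xbar - xLS) i) ≤ κ / 5 :=
      (mul_le_mul_of_nonneg_left (hxK i hi) (by positivity)).trans hρhK
    have h4 : ρ * h * gnorm grp (xbar - xLS) i ≤ 1 / 10 := by
      refine le_of_mul_le_mul_left ?_ hκ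
      linarith
    have h5 : 2 * Ld * h ≤ ρ * h * gnorm grp xbar i := by
      have := mul_le_mul_of_nonneg_right (hρmin.le.trans (mul_le_mul_of_nonneg_left h2 hρ.le)) hh0.le
      linarith
    have h6 := mul_le_mul_of_nonneg_left h1 (by positivity : 0 ≤ ρ * h)
    linarith
  -- wrong weights
  set F : ℕ → ℝ := fun k => (S.filter (fun i => w k i < 1)).card with hF
  set N : ℕ → ℝ := fun k => (Sᶜ.filter (fun i => tb < w k i)).card with hN
  set E : ℕ → ℝ := fun k => ∑ j, (x k - xLS) j ^ 2 with hE
  have hF0 : ∀ k, 0 ≤ F k := fun k => Nat.cast_nonneg _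
  have hN0 : ∀ k, 0 ≤ N k := fun k => Nat.cast_nonneg _
  have hE0 : ∀ k, 0 ≤ E k := fun k => Finset.sum_nonneg fun _ _ => sq_nonneg _
  -- On S, a weight below 1 forces ρ h ‖x_i‖ ≤ Ld h, while `hsig` puts the oracle at 2 Ld h - 1/10
  -- or more; since Ld h ≥ 1 the gap is at least 9/10.
  have hwrong : ∀ k, (9 / 10) ^ 2 * F (k + 1) + N (k + 1) ≤ (ρ * h) ^ 2 * E (k + 1) := by
    intro k
    refine card_wrong_le (by positivity) (by norm_num) hLS.1 ?_ ?_
    · intro i _ hwi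
      by_contra! hlt
      refine absurd (hφ.le_tBar_of_minimizer (s := ρ * gnorm grp (x (k + 1)) i)
        (hrun.w_mem k i) (fun v hv => ?_) ?_) (not_le.2 hwi)
      · have := hrun.w_min k i v hv
        linarith
      · rw [lt_div_iff₀ hh0]
        linarith
    · intro i hi hwi
      have h1 := hφ.le_leftDerivOne_of_minimizer (s := ρ * gnorm grp (x (k + 1)) i)
        (hrun.w_mem k i) (fun v hv => by have := hrun.w_min k i v hv; linarith) hwi
      have h2 := hsig i hi
      have h3 := mul_le_mul_of_nonneg_right h1 hh0.le
      linarith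
  have hw01 : ∀ k i, w k i ∈ Set.Icc (0 : ℝ) 1 := by
    rintro (_ | k) i
    · exact ⟨(hrun.init i).1, (hrun.init i).2.trans htb1.le⟩
    · exact hrun.w_mem k i
  have hstage : ∀ k (lam : ℝ), lam = stepLambda ν ρ k → 0 < lam → 2 * K ≤ lam * (1 - tb) →
      N k ≤ 0.5 * S.card → κ ^ 2 * E (k + 1) ≤ lam ^ 2 * F k + K ^ 2 * N k := by
    intro k lam hlam hlam0 hKlam hNk
    refine stage_error_le hκ htb0 htb1 hRSC hLS.1 (hw01 k) hlam0 hK0 hKlam ?_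
      (fun j hj => hLS.lossGrad_eq_zero hj) hgK ?_
    · rw [hlam]
      exact hrun.x_min k xLS hbox
    · change (S.card : ℝ) + N k ≤ _
      linarith
  have hNzero : N 0 = 0 := by
    simp only [hN, Nat.cast_eq_zero, Finset.card_eq_zero]
    refine Finset.filter_eq_empty_iff.2 fun i _ => not_lt.2 (hrun.init i).2
  have hfirst : (κ * ν) ^ 2 * E 1 ≤ S.card := by
    have h1 := hstage 0 ν⁻¹ (by simp [stepLambda]) (by positivity)
      (by rw [inv_mul_eq_div, le_div_iff₀ hν]; linarith) (by rw [hNzero]; positivity)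
    have h2 : F 0 ≤ S.card := Nat.cast_le.2 (Finset.card_filter_le _ _)
    rw [hNzero, mul_zero, add_zero] at h1
    have h3 := mul_le_mul_of_nonneg_left h1 (sq_nonneg ν)
    have h4 : ν ^ 2 * (ν⁻¹ ^ 2 * F 0) = F 0 := by field_simp
    linarith
  -- Q² is the contraction factor of the squared error: `hFN` contributes (ρ h / (9/10))² and
  -- `hnext` contributes (ρ / (κ ν))².
  set Q := ρ ^ 2 * h / (9 / 10 * (κ * ν)) with hQ
  have hQ0 : 0 ≤ Q := by positivity
  have hQ1 : Q ≤ 1 := by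
    rw [hQ, div_le_one (by positivity)]
    have : ρ ^ 2 * h * (38 / 5) ≤ ρ ^ 2 * (h * c) := by
      rw [← mul_assoc]
      exact mul_le_mul_of_nonneg_left hc7 (by positivity)
    linarith
  -- This invariant keeps S together with its outside wrong groups within 1.5 |S|, the size allowed
  -- by the cone. Both the lower bound on ν and the upper bound on ρ are used.
  have hhalf : ∀ k, (κ * ν) ^ 2 * E (k + 1) ≤ S.card → N (k + 1) ≤ 0.5 * S.card := by
    intro k hEk
    have h1 := hwrong k
    have h2 : (ρ * h) ^ 2 * 2 ≤ (κ * ν) ^ 2 := by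
      have h3 : ρ ^ 2 * h * (38 / 5) ≤ 4 * (κ * ν) := by
        refine le_trans ?_ hρsq
        rw [← mul_assoc]
        exact mul_le_mul_of_nonneg_left hc7 (by positivity)
      have h4 : h * (38 / 5) ≤ 4 * (κ * ν) :=
        (mul_le_mul_of_nonneg_left hc7 hh0.le).trans hy.le
      have h5 := mul_le_mul h3 h4 (by positivity) (by positivity)
      have h6 : (ρ * h) ^ 2 * 2 = ρ ^ 2 * h * (38 / 5) * (h * (38 / 5)) * (50 / 1444) := by ring
      have h7 := sq_nonneg (κ * ν)
      rw [h6]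
      linarith
    have h3 := mul_le_mul_of_nonneg_right h2 (hE0 (k + 1))
    have h4 := hF0 (k + 1)
    linarith
  have hnext : ∀ k, N (k + 1) ≤ 0.5 * S.card →
      (κ * ν) ^ 2 * E (k + 2) ≤ ρ ^ 2 * (F (k + 1) + N (k + 1)) := by
    intro k hNk
    have h1 := hstage (k + 1) (ρ * ν⁻¹) (by simp [stepLambda]) (by positivity)
      (by
        rw [mul_right_comm, ← div_eq_mul_inv, le_div_iff₀ hν]
        nlinarith) hNk
    have h2 : (K * ν) ^ 2 ≤ ρ ^ 2 := by
      refine pow_le_pow_left₀ (by positivity) ?_ 2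
      nlinarith
    have h3 := mul_le_mul_of_nonneg_left h1 (sq_nonneg ν)
    have h4 : ν ^ 2 * ((ρ * ν⁻¹) ^ 2 * F (k + 1) + K ^ 2 * N (k + 1)) =
        ρ ^ 2 * F (k + 1) + (K * ν) ^ 2 * N (k + 1) := by field_simp
    have h5 := mul_le_mul_of_nonneg_right h2 (hN0 (k + 1))
    linarith
  have hFN : ∀ k, F (k + 1) + N (k + 1) ≤ (ρ * h / (9 / 10)) ^ 2 * E (k + 1) := by
    intro k
    have h1 := hwrong k
    rw [div_pow, div_mul_eq_mul_div, le_div_iff₀ (by norm_num)]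
    have h2 := hN0 (k + 1)
    linarith
  have hrate : ∀ k, (κ * ν) ^ 2 * E (k + 1) ≤ Q ^ (2 * k) * S.card := by
    intro k
    induction k with
    | zero => simpa using hfirst
    | succ k ih =>
      have h1 := hnext k (hhalf k (ih.trans
        (mul_le_of_le_one_left (Nat.cast_nonneg _) (pow_le_one₀ hQ0 hQ1))))
      have h2 := mul_le_mul_of_nonneg_left (hFN k) (sq_nonneg ρ)
      have h3 : ρ ^ 2 * ((ρ * h / (9 / 10)) ^ 2 * E (k + 1)) = Q ^ 2 * ((κ * ν) ^ 2 * E (k + 1)) := by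
        rw [hQ]
        field_simp
      have h4 := mul_le_mul_of_nonneg_left ih (sq_nonneg Q)
      rw [show 2 * (k + 1) = 2 + 2 * k by ring, pow_add, mul_assoc]
      linarith
  -- Stage k + 2 uses the weights computed from x (k + 1), which is why k ≥ 2 is required: the
  -- initial weights need not be correct.
  obtain ⟨k, rfl⟩ : ∃ l, k = l + 2 := ⟨k - 2, by omega⟩
  set q := max 1 ρ * ρ * h * c / (6 * ν * κ) with hq
  have hnum : max 1 ρ * ρ * h * c < 6 * ν * κ := by
    rcases le_total ρ 1 with h1 | h1
    · rw [max_eq_left h1]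
      have : ρ * (h * c) ≤ h * c := mul_le_of_le_one_left (by positivity) h1
      linarith
    · rw [max_eq_right h1]
      linarith
  have hm0 : 0 < max 1 ρ := lt_max_of_lt_left one_pos
  have hpow := pow_mul_le_one_of_kBar_le (k := k + 1) hr1 (by positivity) (by positivity) hnum hk
  rw [← hq] at hpow
  -- The rate q used in k̄ is larger than needed because c / 6 > 10 / 9; this slack gives the strict
  -- inequality in `hsmall`.
  have hβ : ρ * h / (9 / 10) / (κ * ν) < q := by
    rw [hq, div_div, div_lt_div_iff₀ (by positivity) (by positivity)]
    have h1 : 1 * (38 / 5) ≤ max 1 ρ * c := mul_le_mul (le_max_left _ _) hc7 (by norm_num) hm0.le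
    have h2 := mul_le_mul_of_nonneg_left h1 (by positivity : 0 ≤ ρ * h * (κ * ν))
    have h3 : 0 < ρ * h * (κ * ν) := by positivity
    linarith
  have hQq : Q ≤ q := by
    rw [hQ, hq, div_le_div_iff₀ (by positivity) (by positivity)]
    have h1 : ρ * (38 / 5) ≤ max 1 ρ * c := mul_le_mul (le_max_right _ _) hc7 (by norm_num) hm0.le
    have h2 := mul_le_mul_of_nonneg_left h1 (by positivity : 0 ≤ ρ * h * (κ * ν))
    have h3 : 0 < ρ * ρ * h * (κ * ν) := by positivity
    linarith
  have hsmall : F (k + 1) + N (k + 1) < 1 := by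
    refine (hFN k).trans_lt ?_
    have h1 : (ρ * h / (9 / 10)) ^ 2 * E (k + 1) =
        (ρ * h / (9 / 10) / (κ * ν)) ^ 2 * ((κ * ν) ^ 2 * E (k + 1)) := by field_simp
    have hq0 : 0 < q := by positivity
    have hr0 : (0 : ℝ) < S.card := by exact_mod_cast hr1
    calc _ ≤ (ρ * h / (9 / 10) / (κ * ν)) ^ 2 * (q ^ (2 * k) * S.card) := by
          rw [h1]
          refine mul_le_mul_of_nonneg_left ((hrate k).trans ?_) (sq_nonneg _)
          gcongr
      _ < q ^ 2 * (q ^ (2 * k) * S.card) := by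
          refine mul_lt_mul_of_pos_right ?_ (by positivity)
          exact pow_lt_pow_left₀ hβ (by positivity) two_ne_zero
      _ = q ^ (2 * (k + 1)) * S.card := by ring
      _ ≤ 1 := hpow
  have hzero : F (k + 1) + N (k + 1) = 0 := by
    simp only [hF, hN] at hsmall ⊢
    norm_cast at hsmall ⊢
    omega
  have hEz : E (k + 2) = 0 := by
    have h1 := hnext k (by
      have := hF0 (k + 1)
      have h2 : (0 : ℝ) ≤ 0.5 * S.card := by positivity
      linarith)
    rw [hzero, mul_zero] at h1
    have h2 : 0 < (κ * ν) ^ 2 := by positivity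
    exact le_antisymm (by by_contra! h3; nlinarith [mul_pos h2 h3]) (hE0 _)
  have hxeq : x (k + 2) = xLS := by
    funext j
    have := (Finset.sum_eq_zero_iff_of_nonneg fun _ _ => sq_nonneg _).1 hEz j (Finset.mem_univ _)
    exact sub_eq_zero.1 (pow_eq_zero_iff two_ne_zero |>.1 this)
  refine ⟨hxeq, ?_⟩
  rw [hxeq]
  refine Finset.Subset.antisymm hLS.1 fun i hi => (mem_groupSupport _ _ _).2 fun h0 => ?_
  have := hsig i hi
  rw [h0] at this
  linarith

/-! ### Noise functionals of the oracle solution -/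

/-- Riesz representation of a functional on the image of a subspace. -/
theorem exists_inner_map_eq {F E : Type*} [AddCommGroup F] [Module ℝ F] [NormedAddCommGroup E]
    [InnerProductSpace ℝ E] [FiniteDimensional ℝ E] (T : F →ₗ[ℝ] E) (W : Submodule ℝ F)
    (l : F →ₗ[ℝ] ℝ) {C : ℝ} (hl : ∀ z ∈ W, |l z| ≤ C * ‖T z‖) :
    ∃ v ∈ W.map T, ‖v‖ ≤ max C 0 ∧ ∀ z ∈ W, inner ℝ v (T z) = l z := by
  -- The bound makes l vanish on the kernel of T restricted to W, so l factors through T there.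
  have hmem : l ∘ₗ W.subtype ∈ LinearMap.range (T ∘ₗ W.subtype).dualMap := by
    rw [LinearMap.range_dualMap_eq_dualAnnihilator_ker, Submodule.mem_dualAnnihilator]
    intro z hz
    have h := hl z z.2
    rw [show T z = 0 from hz, norm_zero, mul_zero] at h
    exact abs_nonpos_iff.1 h
  obtain ⟨f, hf⟩ := hmem
  set v₀ : E := (InnerProductSpace.toDual ℝ E).symm (LinearMap.toContinuousLinearMap f) with hv₀
  have hv₀f : ∀ y, inner ℝ v₀ y = f y := fun y => by
    rw [hv₀, InnerProductSpace.toDual_symm_apply]; rfl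
  set V := W.map T with hV
  have hin : ∀ z ∈ W, inner ℝ (V.starProjection v₀) (T z) = l z := by
    intro z hz
    have h1 := V.starProjection_inner_eq_zero v₀ (T z) ⟨z, hz, rfl⟩
    rw [inner_sub_left, sub_eq_zero, hv₀f] at h1
    rw [← h1]
    exact LinearMap.congr_fun hf ⟨z, hz⟩
  refine ⟨V.starProjection v₀, V.starProjection_apply_mem v₀, ?_, hin⟩
  -- The projected representer is itself some T z with z in W; testing it against itself bounds its
  -- norm by C.
  obtain ⟨z, hz, hzv⟩ := V.starProjection_apply_mem v₀
  have h1 := hin z hz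
  rw [hzv, real_inner_self_eq_norm_sq] at h1
  have h2 := hl z hz
  rw [hzv, ← h1, abs_of_nonneg (sq_nonneg _), sq] at h2
  rcases (norm_nonneg (V.starProjection v₀)).eq_or_lt with h0 | h0
  · rw [← h0]; exact le_max_right _ _
  · exact (le_of_mul_le_mul_right h2 h0).trans (le_max_left _ _)

/-- The design as a linear map into Euclidean space. -/
def designMap (A : Matrix (Fin n) (Fin p) ℝ) : (Fin p → ℝ) →ₗ[ℝ] EuclideanSpace ℝ (Fin n) :=
  (WithLp.linearEquiv 2 ℝ (Fin n → ℝ)).symm.toLinearMap ∘ₗ A.mulVecLin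

theorem designMap_apply (A : Matrix (Fin n) (Fin p) ℝ) (z : Fin p → ℝ) (r : Fin n) :
    designMap A z r = (A.mulVec z) r := rfl

theorem norm_designMap_sq (A : Matrix (Fin n) (Fin p) ℝ) (z : Fin p → ℝ) :
    ‖designMap A z‖ ^ 2 = ∑ r, (A.mulVec z) r ^ 2 := by
  rw [EuclideanSpace.norm_sq_eq]
  simp [designMap_apply]

theorem norm_designMap_single (A : Matrix (Fin n) (Fin p) ℝ) (j : Fin p) :
    ‖designMap A (Pi.single j 1)‖ ≤ maxColNorm A := by
  rw [EuclideanSpace.norm_eq]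
  simp only [designMap_apply, Matrix.mulVec_single_one, Real.norm_eq_abs, sq_abs]
  exact le_ciSup (f := fun j => √(∑ r, A r j ^ 2)) (Set.finite_range _).bddAbove j

/-- The vectors supported on the groups of `S`. -/
def groupSubspace (grp : Fin p → Fin m) (S : Finset (Fin m)) : Submodule ℝ (Fin p → ℝ) where
  carrier := {z | groupSupport grp z ⊆ S}
  add_mem' := by
    simp only [Set.mem_ofPred_eq, groupSupport_subset_iff]
    intro a b ha hb j hj
    simp [ha j hj, hb j hj]
  zero_mem' := by simp [groupSupport_subset_iff]
  smul_mem' := by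
    simp only [Set.mem_ofPred_eq, groupSupport_subset_iff]
    intro c a ha j hj
    simp [ha j hj]

theorem mem_groupSubspace {grp : Fin p → Fin m} {S : Finset (Fin m)} {z : Fin p → ℝ} :
    z ∈ groupSubspace grp S ↔ groupSupport grp z ⊆ S := Iff.rfl

theorem mem_cone_of_groupSupport_subset {grp : Fin p → Fin m} {S : Finset (Fin m)} {z : Fin p → ℝ}
    {tb l : ℝ} (htb : tb < 1) (hl : (S.card : ℝ) ≤ l) (hz : groupSupport grp z ⊆ S) :
    z ∈ cone tb grp S l := by
  refine ⟨S, subset_rfl, hl, ?_⟩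
  rw [Finset.sum_eq_zero fun i hi => gnorm_eq_zero_of_notMem hz (Finset.mem_compl.1 hi)]
  exact mul_nonneg (div_nonneg zero_le_two (by linarith))
    (Finset.sum_nonneg fun i _ => gnorm_nonneg _ _ _)

theorem RSC.pos_rows {A : Matrix (Fin n) (Fin p) ℝ} {κ : ℝ} {C : Set (Fin p → ℝ)}
    (h : RSC A κ C) (hκ : 0 < κ) {z : Fin p → ℝ} (hz : z ∈ C) (hz0 : z ≠ 0) : 0 < n := by
  rcases Nat.eq_zero_or_pos n with rfl | hn
  · exfalso
    obtain ⟨j, hj⟩ := Function.ne_iff.1 hz0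
    have h1 := h z hz
    simp only [Finset.univ_eq_empty, Finset.sum_empty, mul_zero] at h1
    have h2 : 0 < ∑ j, z j ^ 2 :=
      Finset.sum_pos' (fun _ _ => sq_nonneg _) ⟨j, Finset.mem_univ _, by
        have : z j ≠ 0 := hj
        positivity⟩
    nlinarith [mul_pos hκ h2]
  · exact hn

/-- The noise enters the oracle error and the off-support gradient through fixed linear
functionals of norm at most the largest column norm. -/
theorem exists_noise_functionals {grp : Fin p → Fin m} {A : Matrix (Fin n) (Fin p) ℝ}
    {xbar : Fin p → ℝ} {κ tb l : ℝ} (hx0 : xbar ≠ 0) (hκ : 0 < κ) (htb : tb < 1)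
    (hl : ((groupSupport grp xbar).card : ℝ) ≤ l)
    (hRSC : RSC A κ (cone tb grp (groupSupport grp xbar) l)) :
    0 < n ∧ 0 < maxColNorm A ∧ ∃ v : Fin p → EuclideanSpace ℝ (Fin n),
      (∀ j, ‖v j‖ ≤ maxColNorm A) ∧
      ∀ (e : Fin n → ℝ) (xLS : Fin p → ℝ),
        IsOracleLS grp A (fun r => (A.mulVec xbar) r + e r) (groupSupport grp xbar) xLS → ∀ j,
          (grp j ∈ groupSupport grp xbar →
            2 * n * κ * (xLS j - xbar j) = ∑ r, v j r * e r) ∧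
          (grp j ∉ groupSupport grp xbar →
            n * lossGrad A (fun r => (A.mulVec xbar) r + e r) xLS j = -∑ r, v j r * e r) := by
  set S := groupSupport grp xbar with hS
  set M := maxColNorm A with hM
  have hcone : ∀ z, groupSupport grp z ⊆ S → z ∈ cone tb grp S l := fun z hz =>
    mem_cone_of_groupSupport_subset htb hl hz
  have hn : 0 < n := hRSC.pos_rows hκ (hcone xbar subset_rfl) hx0
  have hn' : (0 : ℝ) < n := by exact_mod_cast hn
  set T := designMap A with hT
  set W := groupSubspace grp S with hW
  have hlow : ∀ z ∈ W, 2 * n * κ * ∑ j, z j ^ 2 ≤ ‖T z‖ ^ 2 := by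
    intro z hz
    have := hRSC z (hcone z hz)
    rw [← norm_designMap_sq, div_mul_eq_mul_div, one_mul, le_div_iff₀ (by positivity)] at this
    linarith
  obtain ⟨j₀, hj₀⟩ := Function.ne_iff.1 hx0
  have hj₀S : grp j₀ ∈ S := (mem_groupSupport grp xbar _).2 fun h =>
    hj₀ ((gnorm_eq_zero_iff grp xbar _).1 h j₀ rfl)
  have hsingle : Pi.single j₀ (1 : ℝ) ∈ W := groupSupport_subset_iff.2 fun k hk => by
    have : k ≠ j₀ := by rintro rfl; exact hk hj₀S
    simp [this]
  have hM0 : 0 ≤ M := (norm_nonneg _).trans (norm_designMap_single A j₀)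
  -- RSC on a single basis vector compares κ with a column norm; this is what normalizes the
  -- functionals on the support to norm at most M.
  have hMsq : 2 * n * κ ≤ M ^ 2 := by
    have h1 := hlow _ hsingle
    have h2 := pow_le_pow_left₀ (norm_nonneg _) (norm_designMap_single A j₀) 2
    have h3 : ∑ j, (Pi.single j₀ (1 : ℝ) : Fin p → ℝ) j ^ 2 = 1 := by
      simp [Pi.single_apply]
    rw [h3, mul_one] at h1
    exact h1.trans h2
  have hMpos : 0 < M := by
    refine lt_of_le_of_ne hM0 fun h => ?_
    rw [← h] at hMsq
    have : 0 < 2 * n * κ := by positivity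
    linarith
  refine ⟨hn, hMpos, ?_⟩
  have horth : ∀ (e : Fin n → ℝ) (xLS : Fin p → ℝ),
      IsOracleLS grp A (fun r => (A.mulVec xbar) r + e r) S xLS → ∀ d ∈ W,
        inner ℝ (T d) (T (xLS - xbar) - WithLp.toLp 2 e) = 0 := by
    intro e xLS h d hd
    have h1 := h.sum_lossGrad_mul_eq_zero hd
    rw [sum_lossGrad_mul] at h1
    have h2 := (mul_eq_zero.1 h1).resolve_left (by positivity)
    rw [← h2, PiLp.inner_apply]
    refine Finset.sum_congr rfl fun r _ => ?_
    simp only [hT, map_sub, PiLp.sub_apply, designMap_apply]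
    simp only [RCLike.inner_apply, conj_trivial]
    ring
  have hzW : ∀ (b : Fin n → ℝ) (xLS : Fin p → ℝ),
      IsOracleLS grp A b S xLS → xLS - xbar ∈ W := fun b xLS h =>
    W.sub_mem (show xLS ∈ W from h.1) (mem_groupSubspace.2 subset_rfl)
  have hsum : ∀ (v : EuclideanSpace ℝ (Fin n)) (e : Fin n → ℝ),
      inner ℝ v (WithLp.toLp 2 e) = ∑ r, v r * e r := by
    intro v e
    rw [PiLp.inner_apply]
    refine Finset.sum_congr rfl fun r _ => ?_
    simp only [RCLike.inner_apply, conj_trivial]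
    ring
  have hex : ∀ j, ∃ v : EuclideanSpace ℝ (Fin n), ‖v‖ ≤ M ∧
      ∀ (e : Fin n → ℝ) (xLS : Fin p → ℝ),
        IsOracleLS grp A (fun r => (A.mulVec xbar) r + e r) S xLS →
          (grp j ∈ S → 2 * n * κ * (xLS j - xbar j) = ∑ r, v r * e r) ∧
          (grp j ∉ S →
            n * lossGrad A (fun r => (A.mulVec xbar) r + e r) xLS j = -∑ r, v r * e r) := by
    intro j
    by_cases hj : grp j ∈ S
    -- On the support: represent z ↦ 2nκ z_j by a vector v in T(W). The oracle residual is
    -- orthogonal to T(W), so v pairs equally with T(xLS - xbar) and with the noise.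
    · obtain ⟨v, ⟨d, hd, hdv⟩, hvM, hv⟩ := exists_inner_map_eq T W
        ((2 * n * κ) • LinearMap.proj j) (C := M) (by
          intro z hz
          refine abs_le_of_sq_le_sq ?_ (mul_nonneg hM0 (norm_nonneg _))
          have h1 : z j ^ 2 ≤ ∑ j, z j ^ 2 :=
            Finset.single_le_sum (f := fun j => z j ^ 2) (fun _ _ => sq_nonneg _)
              (Finset.mem_univ j)
          have h2 := hlow z hz
          simp only [LinearMap.smul_apply, LinearMap.proj_apply, smul_eq_mul]
          calc (2 * n * κ * z j) ^ 2 = 2 * n * κ * (2 * n * κ * z j ^ 2) := by ring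
            _ ≤ 2 * n * κ * (2 * n * κ * ∑ j, z j ^ 2) := by gcongr
            _ ≤ M ^ 2 * ‖T z‖ ^ 2 := mul_le_mul hMsq h2 (by positivity) (by positivity)
            _ = _ := by ring)
      refine ⟨v, by rwa [max_eq_left hM0] at hvM, fun e xLS h => ⟨fun _ => ?_, fun h' => absurd hj h'⟩⟩
      have h1 := horth e xLS h d hd
      rw [hdv, inner_sub_right, sub_eq_zero, hv _ (hzW _ _ h), hsum] at h1
      simpa using h1
    -- Off the support: take the j-th column minus its projection onto T(W). The projection pairs to
    -- zero with the residual, and the remainder pairs to zero with T(xLS - xbar), so only the noise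
    -- is left.
    · set V := W.map T with hV
      set a := T (Pi.single j 1) with ha
      refine ⟨a - V.starProjection a, ?_, fun e xLS h => ⟨fun h' => absurd h' hj, fun _ => ?_⟩⟩
      · refine le_trans ?_ (norm_designMap_single A j)
        rw [← Submodule.starProjection_orthogonal_val]
        exact Submodule.norm_starProjection_apply_le _ _
      · rw [← hsum]
        obtain ⟨d, hd, hda⟩ := V.starProjection_apply_mem a
        have h1 := horth e xLS h d hd
        have h2 := V.starProjection_inner_eq_zero a (T (xLS - xbar)) ⟨_, hzW _ _ h, rfl⟩
        have h3 : n * lossGrad A (fun r => (A.mulVec xbar) r + e r) xLS j =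
            inner ℝ a (T (xLS - xbar) - WithLp.toLp 2 e) := by
          rw [lossGrad, ← mul_assoc, mul_one_div_cancel hn'.ne', one_mul, PiLp.inner_apply]
          refine Finset.sum_congr rfl fun r _ => ?_
          simp only [ha, hT, map_sub, PiLp.sub_apply, designMap_apply, Matrix.mulVec_single_one]
          simp only [RCLike.inner_apply, conj_trivial, Matrix.col_apply]
          ring
        rw [hda] at h1
        rw [h3]
        rw [inner_sub_right] at h1 ⊢
        rw [inner_sub_left] at h2 ⊢
        linarith
  choose v hv1 hv2 using hex
  exact ⟨v, hv1, fun e xLS h j => hv2 j e xLS h⟩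

/-! ### Sub-Gaussian noise -/

theorem HasSubgaussianMGF.mono_param {Ω : Type*} [MeasurableSpace Ω] {P : Measure Ω} {X : Ω → ℝ}
    {c d : NNReal} (h : HasSubgaussianMGF X c P) (hcd : c ≤ d) : HasSubgaussianMGF X d P where
  integrable_exp_mul := h.integrable_exp_mul
  mgf_le t := (h.mgf_le t).trans <| Real.exp_le_exp.2 <| by
    have : (c : ℝ) ≤ d := hcd
    gcongr

/-- Two-sided tail bound for a linear functional of independent sub-Gaussian variables. -/
theorem measureReal_abs_linear_gt_le {Ω : Type*} [MeasurableSpace Ω] {P : Measure Ω}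
    [IsProbabilityMeasure P] {ε : Fin n → Ω → ℝ} {σ : NNReal} (hind : iIndepFun ε P)
    (hsub : ∀ r, HasSubgaussianMGF (ε r) (σ ^ 2) P) {v : EuclideanSpace ℝ (Fin n)} {M : ℝ}
    (hv : ‖v‖ ≤ M) {τ : ℝ} (hτ : 0 ≤ τ) :
    P.real {ω | τ < |∑ r, v r * ε r ω|} ≤ 2 * Real.exp (-τ ^ 2 / (2 * (M ^ 2 * σ ^ 2))) := by
  have hX : HasSubgaussianMGF (fun ω => ∑ r, v r * ε r ω) ((M ^ 2).toNNReal * σ ^ 2) P := by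
    have h0 : ∀ r, HasSubgaussianMGF (fun ω => v r * ε r ω) ((v r ^ 2).toNNReal * σ ^ 2) P := by
      intro r
      rw [Real.toNNReal_of_nonneg (sq_nonneg (v r))]
      exact (hsub r).const_mul (v r)
    have h1 := HasSubgaussianMGF.sum_of_iIndepFun (s := Finset.univ)
      (hind.comp (fun r => fun y : ℝ => v r * y) fun r => measurable_const_mul _)
      fun r _ => h0 r
    refine HasSubgaussianMGF.mono_param h1 ?_
    rw [← Finset.sum_mul, ← Real.toNNReal_sum_of_nonneg fun r _ => sq_nonneg _]
    have h2 := pow_le_pow_left₀ (norm_nonneg _) hv 2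
    rw [EuclideanSpace.norm_sq_eq] at h2
    simp only [Real.norm_eq_abs, sq_abs] at h2
    gcongr
  have h1 := hX.measure_ge_le hτ
  have h2 := hX.neg.measure_ge_le hτ
  push_cast at h1 h2
  rw [Real.coe_toNNReal _ (sq_nonneg M)] at h1 h2
  refine le_trans (measureReal_mono (s₂ := {ω | τ ≤ ∑ r, v r * ε r ω} ∪
    {ω | τ ≤ (-fun ω => ∑ r, v r * ε r ω) ω}) ?_) ((measureReal_union_le _ _).trans ?_)
  · intro ω hω
    rcases lt_abs.1 (show τ < |∑ r, v r * ε r ω| from hω) with h | h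
    · exact Or.inl h.le
    · exact Or.inr h.le
  · linarith

/-- Fixed designs with restricted strong convexity have the oracle recovery property. -/
theorem oracleRecovery_of_RSC {φ : ℝ → EReal} (hφ : MemPhi φ) {grp : Fin p → Fin m}
    {A : Matrix (Fin n) (Fin p) ℝ} {xbar : Fin p → ℝ} {κ : ℝ} (hx0 : xbar ≠ 0) (hκ : 0 < κ)
    (hRSC : RSC A κ (cone (tBar φ) grp (groupSupport grp xbar)
      (1.5 * (groupSupport grp xbar).card))) :
    OracleRecovery.{u} φ grp A κ xbar := by
  intro Ω _ P _ ε σ η hσ hη hη1 hmeas hind hsub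
  obtain ⟨hn, hM, v, hvM, hv⟩ := exists_noise_functionals hx0 hκ hφ.tBar_lt_one
    (by linarith [(Nat.cast_nonneg (groupSupport grp xbar).card : (0 : ℝ) ≤ _)]) hRSC
  have hn' : (0 : ℝ) < n := by exact_mod_cast hn
  have hp : 0 < p := by
    obtain ⟨j, -⟩ := Function.ne_iff.1 hx0
    exact j.pos
  have hp' : (1 : ℝ) ≤ p := by exact_mod_cast hp
  set M := maxColNorm A with hMdef
  set ℓ := Real.log (2 * p / η) with hℓ
  have hℓ0 : 0 ≤ ℓ := Real.log_nonneg (by rw [le_div_iff₀ hη]; linarith)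
  -- At this threshold the two-sided tail is 2 exp(-ℓ) = η / p.
  set τ : ℝ := σ * √(2 * ℓ) * M with hτ
  have hσ' : (0 : ℝ) < σ := hσ
  have hτ0 : 0 ≤ τ := by positivity
  have hnoise : noiseLevel grp A σ η = √(maxGroupSize grp) * (τ / n) := by
    rw [noiseLevel, ← hMdef, ← hℓ, hτ, show 2 * (maxGroupSize grp : ℝ) * ℓ =
      maxGroupSize grp * (2 * ℓ) by ring, Real.sqrt_mul (by positivity)]
    ring
  have hlin : ∀ j, Measurable fun ω => |∑ r, v j r * ε r ω| := fun j =>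
    (Finset.measurable_sum _ fun r _ => (hmeas r).const_mul _).abs
  set B : Fin p → Set Ω := fun j => {ω | τ < |∑ r, v j r * ε r ω|} with hB
  have hBmeas : ∀ j, MeasurableSet (B j) := fun j => measurableSet_lt measurable_const (hlin j)
  have hBprob : ∀ j, P.real (B j) ≤ η / p := by
    intro j
    refine (measureReal_abs_linear_gt_le hind hsub (hvM j) hτ0).trans_eq ?_
    have h1 : -τ ^ 2 / (2 * (M ^ 2 * (σ : ℝ) ^ 2)) = -ℓ := by
      rw [hτ, mul_pow, mul_pow, Real.sq_sqrt (by positivity)]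
      field_simp
    rw [h1, Real.exp_neg, hℓ, Real.exp_log (by positivity)]
    field_simp
  -- One functional per coordinate serves both noise bounds, so the loss is η, half of what is
  -- allowed.
  have hUnion : P.real (⋃ j, B j) ≤ η := by
    refine (measureReal_iUnion_fintype_le _).trans ((Finset.sum_le_sum fun j _ => hBprob j).trans ?_)
    rw [Finset.sum_const, Finset.card_univ, Fintype.card_fin, nsmul_eq_mul,
      mul_div_cancel₀ _ (by positivity)]
  refine ⟨(⋃ j, B j)ᶜ, (MeasurableSet.iUnion hBmeas).compl, ?_, ?_⟩
  · rw [probReal_compl_eq_one_sub (MeasurableSet.iUnion hBmeas)]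
    linarith
  · intro ω hω R ν ρ _ hν₁ hν₂ hρ₁ hρ₂ xLS hLS hbox x w hrun k hk hk2
    have hsmall : ∀ j, |∑ r, v j r * ε r ω| ≤ τ := by
      intro j
      by_contra! h
      exact hω (Set.mem_iUnion.2 ⟨j, h⟩)
    refine recovery_of_noise_bounds hφ hx0 hκ hRSC (by rw [hnoise]; positivity) hν₁ hν₂ hρ₁ hρ₂
      hLS hbox ?_ ?_ hrun hk hk2
    · intro i hi
      rw [hnoise]
      refine gnorm_le_of_abs_le (by positivity) fun j hj => ?_
      have h1 := (hv _ xLS hLS j).2 (by rwa [hj])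
      rw [le_div_iff₀ hn', mul_comm, ← abs_of_pos hn', ← abs_mul, h1, abs_neg]
      exact hsmall j
    · intro i hi
      have h2 : gnorm grp (xbar - xLS) i ≤ √(maxGroupSize grp) * (τ / (2 * n * κ)) := by
        refine gnorm_le_of_abs_le (by positivity) fun j hj => ?_
        have h1 := (hv _ xLS hLS j).1 (by rwa [hj])
        have h3 : (0 : ℝ) < 2 * n * κ := by positivity
        have h4 := hsmall j
        rw [← h1, abs_mul, abs_of_pos h3] at h4
        rwa [le_div_iff₀ h3, mul_comm, Pi.sub_apply, abs_sub_comm]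
      rw [hnoise]
      calc 2 * κ * gnorm grp (xbar - xLS) i
          ≤ 2 * κ * (√(maxGroupSize grp) * (τ / (2 * n * κ))) := by gcongr
        _ = _ := by field_simp

/-! ### Sparsification of a quadratic form -/

section Sparsify

variable {F ι : Type*} [AddCommGroup F] [Module ℝ F] [Fintype ι]

/-- The bias–variance identity: the deviations U i - z average to zero, so the cross terms cancel.
Neither symmetry nor positivity of the form is needed. -/
theorem sum_mul_bilin_add_sub (B : LinearMap.BilinForm ℝ F) {π : ι → ℝ} (hπ : ∑ i, π i = 1)
    {U : ι → F} {z : F} (hz : ∑ i, π i • U i = z) (y : F) :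
    ∑ i, π i * B (y + (U i - z)) (y + (U i - z)) =
      B y y + (∑ i, π i * B (U i) (U i) - B z z) := by
  have h1 : ∀ a, ∑ i, π i * B a (U i) = B a z := fun a => by
    rw [← hz, map_sum]; simp
  have h2 : ∀ a, ∑ i, π i * B (U i) a = B z a := fun a => by
    rw [← hz, map_sum, LinearMap.sum_apply]; simp
  have h3 : ∀ i, π i * B (y + (U i - z)) (y + (U i - z)) =
      π i * B (y - z) (y - z) + π i * B (y - z) (U i) + π i * B (U i) (y - z)
        + π i * B (U i) (U i) := fun i => by
    rw [show y + (U i - z) = (y - z) + U i by abel]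
    simp only [map_add, LinearMap.add_apply]
    ring
  simp_rw [h3, Finset.sum_add_distrib, h1, h2, ← Finset.sum_mul, hπ]
  simp only [map_sub, LinearMap.sub_apply]
  ring

/-- Maurey's empirical method, derandomized: some index does no worse than the average, so the
samples can be chosen one at a time, each adding at most the variance. -/
theorem exists_sum_le_of_average (B : LinearMap.BilinForm ℝ F) {π : ι → ℝ} (hπ0 : ∀ i, 0 ≤ π i)
    (hπ : ∑ i, π i = 1) {U : ι → F} {z : F} (hz : ∑ i, π i • U i = z) (y : F) (k : ℕ) :
    ∃ t : Fin k → ι, B (y + ∑ l, (U (t l) - z)) (y + ∑ l, (U (t l) - z)) ≤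
      B y y + k * (∑ i, π i * B (U i) (U i) - B z z) := by
  induction k with
  | zero => exact ⟨Fin.elim0, by simp⟩
  | succ k ih =>
    obtain ⟨t, ht⟩ := ih
    set y' := y + ∑ l, (U (t l) - z) with hy'
    set V := ∑ i, π i * B (U i) (U i) - B z z with hV
    have havg := sum_mul_bilin_add_sub B hπ hz y'
    obtain ⟨i, hi⟩ : ∃ i, B (y' + (U i - z)) (y' + (U i - z)) ≤ B y' y' + V := by
      by_contra! hcon
      have h1 : ∑ i, π i * (B y' y' + V) < ∑ i, π i * B (y' + (U i - z)) (y' + (U i - z)) := by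
        obtain ⟨i, -, hi⟩ := Finset.exists_ne_zero_of_sum_ne_zero (hπ ▸ one_ne_zero)
        exact Finset.sum_lt_sum (fun i _ => mul_le_mul_of_nonneg_left (hcon i).le (hπ0 i))
          ⟨i, Finset.mem_univ _, mul_lt_mul_of_pos_left (hcon i)
            (lt_of_le_of_ne (hπ0 i) (Ne.symm hi))⟩
      rw [← Finset.sum_mul, hπ, one_mul, havg] at h1
      exact lt_irrefl _ h1
    refine ⟨Fin.snoc t i, ?_⟩
    simp only [Fin.sum_univ_castSucc, Fin.snoc_castSucc, Fin.snoc_last]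
    rw [← add_assoc, ← hy']
    push_cast
    linarith

end Sparsify

/-- A sum of signed standard basis vectors. -/
def signedSum {D : ℕ} (t : Fin D → Fin p) (σ : Fin D → Bool) : Fin p → ℝ :=
  ∑ l, (if σ l then (1 : ℝ) else -1) • (Pi.single (t l) 1 : Fin p → ℝ)

/-- If a quadratic form is nonnegative on all sums of `D` signed basis vectors and bounded on the
basis, then it is almost nonnegative on vectors with small `ℓ¹` norm. -/
theorem neg_le_of_signedSum_nonneg (B : LinearMap.BilinForm ℝ (Fin p → ℝ)) {D : ℕ} {β : ℝ}
    (hD : 0 < D) (hs : ∀ (t : Fin D → Fin p) (σ : Fin D → Bool),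
      0 ≤ B (signedSum t σ) (signedSum t σ))
    (hβ : ∀ j, B (Pi.single j 1) (Pi.single j 1) ≤ β) (z : Fin p → ℝ) :
    -(β * (∑ j, |z j|) ^ 2) ≤ (D - 1) * B z z := by
  set N := ∑ j, |z j| with hN
  have hN0 : 0 ≤ N := Finset.sum_nonneg fun _ _ => abs_nonneg _
  rcases hN0.eq_or_lt with h | h
  · have hz : z = 0 := by
      funext j
      exact abs_eq_zero.1
        ((Finset.sum_eq_zero_iff_of_nonneg fun _ _ => abs_nonneg _).1 h.symm j (Finset.mem_univ _))
    simp [← h, hz]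
  · set sg : Fin p → Bool := fun j => decide (0 ≤ z j) with hsg
    have hsgn : ∀ j, |z j| * (if sg j then (1 : ℝ) else -1) = z j := by
      intro j
      by_cases h0 : 0 ≤ z j
      · simp [hsg, h0, abs_of_nonneg h0]
      · simp [hsg, h0, abs_of_neg (not_le.1 h0)]
    set e : Fin p → (Fin p → ℝ) := fun j =>
      (if sg j then (1 : ℝ) else -1) • (Pi.single j 1 : Fin p → ℝ) with he
    have hez : ∑ j, (|z j| / N) • (N • e j) = z := by
      have : ∀ j, (|z j| / N) • (N • e j) = Pi.single j (z j) := by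
        intro j
        rw [smul_smul, div_mul_cancel₀ _ h.ne', he, smul_smul, hsgn, ← Pi.single_smul,
          smul_eq_mul, mul_one]
      simp_rw [this]
      exact Finset.univ_sum_single z
    -- Starting from D z cancels the D subtracted copies of z, leaving N times a signed sum; the
    -- resulting coefficient of B z z is D² - D.
    obtain ⟨t, ht⟩ := exists_sum_le_of_average B (π := fun j => |z j| / N)
      (fun j => by positivity) (by rw [← Finset.sum_div, div_self h.ne']) hez ((D : ℝ) • z) D
    have hsum : (D : ℝ) • z + ∑ l, (N • e (t l) - z) = N • signedSum t (fun l => sg (t l)) := by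
      rw [Finset.sum_sub_distrib, Finset.sum_const, Finset.card_univ, Fintype.card_fin,
        signedSum, Finset.smul_sum, ← Nat.cast_smul_eq_nsmul ℝ]
      abel
    rw [hsum] at ht
    have he1 : ∀ j, B (e j) (e j) ≤ β := by
      intro j
      refine le_of_eq_of_le ?_ (hβ j)
      simp only [he, map_smul, LinearMap.smul_apply, smul_eq_mul]
      split_ifs <;> ring
    have hEU : ∑ j, |z j| / N * B (N • e j) (N • e j) ≤ N ^ 2 * β := by
      calc _ ≤ ∑ j, |z j| / N * (N ^ 2 * β) := by
            refine Finset.sum_le_sum fun j _ => mul_le_mul_of_nonneg_left ?_ (by positivity)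
            simp only [map_smul, LinearMap.smul_apply, smul_eq_mul]
            rw [← mul_assoc, ← sq]
            exact mul_le_mul_of_nonneg_left (he1 j) (sq_nonneg N)
        _ = _ := by rw [← Finset.sum_mul, ← Finset.sum_div, div_self h.ne', one_mul]
    have hW := mul_nonneg (sq_nonneg N) (hs t fun l => sg (t l))
    simp only [map_smul, LinearMap.smul_apply, smul_eq_mul] at ht hEU
    have hD' : (0 : ℝ) < D := by exact_mod_cast hD
    have h5 := mul_le_mul_of_nonneg_left hEU hD'.le
    refine le_of_mul_le_mul_left ?_ hD'
    linarith

/-! ### The cone in terms of the `ℓ¹` norm -/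

/-- Cauchy–Schwarz inside each group costs the maximal group size, the cone condition reduces the
sum to `T`, and Cauchy–Schwarz over `T` costs `l`. -/
theorem sq_sum_abs_le_of_mem_cone {grp : Fin p → Fin m} {S : Finset (Fin m)} {z : Fin p → ℝ}
    {tb l : ℝ} (htb : tb < 1) (hz : z ∈ cone tb grp S l) :
    (∑ j, |z j|) ^ 2 ≤ (1 + 2 / (1 - tb)) ^ 2 * (maxGroupSize grp * l) * ∑ j, z j ^ 2 := by
  obtain ⟨T, -, hTl, hT⟩ := hz
  set C := 2 / (1 - tb) with hC
  have hC0 : 0 ≤ C := div_nonneg zero_le_two (by linarith)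
  have h1 : ∑ j, |z j| ≤ √(maxGroupSize grp) * ∑ i, gnorm grp z i := by
    rw [sum_eq_sum_groups grp, Finset.mul_sum]
    exact Finset.sum_le_sum fun i _ => sum_abs_group_le grp z i
  have h2 : ∑ i, gnorm grp z i ≤ (1 + C) * ∑ i ∈ T, gnorm grp z i := by
    rw [← Finset.sum_add_sum_compl T]
    linarith
  have h3 : (∑ i ∈ T, gnorm grp z i) ^ 2 ≤ l * ∑ j, z j ^ 2 := by
    have h := sq_sum_mul_gnorm_le grp z T fun _ => 1
    simp only [one_mul, one_pow, Finset.sum_const, nsmul_eq_mul, mul_one] at h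
    exact h.trans (mul_le_mul_of_nonneg_right hTl (Finset.sum_nonneg fun _ _ => sq_nonneg _))
  calc (∑ j, |z j|) ^ 2
      ≤ (√(maxGroupSize grp) * ((1 + C) * ∑ i ∈ T, gnorm grp z i)) ^ 2 :=
        pow_le_pow_left₀ (Finset.sum_nonneg fun _ _ => abs_nonneg _)
          (h1.trans (mul_le_mul_of_nonneg_left h2 (Real.sqrt_nonneg _))) 2
    _ = (1 + C) ^ 2 * maxGroupSize grp * (∑ i ∈ T, gnorm grp z i) ^ 2 := by
        rw [mul_pow, Real.sq_sqrt (by positivity)]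
        ring
    _ ≤ (1 + C) ^ 2 * maxGroupSize grp * (l * ∑ j, z j ^ 2) :=
        mul_le_mul_of_nonneg_left h3 (by positivity)
    _ = _ := by ring

theorem sum_groupSize_le (grp : Fin p → Fin m) (S : Finset (Fin m)) :
    ∑ i ∈ S, groupSize grp i ≤ p := by
  calc ∑ i ∈ S, groupSize grp i ≤ ∑ i, groupSize grp i :=
        Finset.sum_le_sum_of_subset (Finset.subset_univ _)
    _ = p := by
        have := Finset.card_eq_sum_card_fiberwise (s := Finset.univ) (t := Finset.univ) (f := grp)
          fun _ _ => Finset.mem_coe.2 (Finset.mem_univ _)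
        simpa [groupSize] using this.symm

theorem one_le_sum_groupSize {grp : Fin p → Fin m} {x : Fin p → ℝ} (hx : x ≠ 0) :
    1 ≤ ∑ i ∈ groupSupport grp x, groupSize grp i := by
  obtain ⟨j, hj⟩ := Function.ne_iff.1 hx
  have hjS : grp j ∈ groupSupport grp x := (mem_groupSupport grp x _).2 fun h =>
    hj ((gnorm_eq_zero_iff grp x _).1 h j rfl)
  refine le_trans ?_ (Finset.single_le_sum (fun _ _ => Nat.zero_le _) hjS)
  exact Finset.card_pos.2 ⟨j, by simp⟩

/-! ### Quadratic functionals of the Gaussian ensemble -/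

theorem integral_exp_mul_sq_gaussianReal {v : NNReal} (hv : v ≠ 0) {s : ℝ} (hs : 2 * s * v < 1) :
    ∫ x, Real.exp (s * x ^ 2) ∂gaussianReal 0 v = (√(1 - 2 * s * v))⁻¹ := by
  have hv0 : (0 : ℝ) < v := by positivity
  have hb : 0 < 1 - 2 * s * v := by linarith
  rw [integral_gaussianReal_eq_integral_smul hv]
  have : ∀ x : ℝ, gaussianPDFReal 0 v x • Real.exp (s * x ^ 2) =
      (√(2 * Real.pi * v))⁻¹ * Real.exp (-((1 - 2 * s * v) / (2 * v)) * x ^ 2) := by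
    intro x
    rw [gaussianPDFReal, smul_eq_mul, mul_assoc, ← Real.exp_add]
    congr 2
    field_simp
    ring
  simp_rw [this]
  rw [integral_const_mul, integral_gaussian,
    show Real.pi / ((1 - 2 * s * v) / (2 * v)) = 2 * Real.pi * v / (1 - 2 * s * v) by
      field_simp, Real.sqrt_div (by positivity), ← mul_div_assoc,
    inv_mul_cancel₀ (by positivity), one_div]

theorem map_dotProduct_multivariateGaussian {Sig : Matrix (Fin p) (Fin p) ℝ} (hS : Sig.PosSemidef)
    (v : Fin p → ℝ) :
    (multivariateGaussian 0 Sig).map (fun z : EuclideanSpace ℝ (Fin p) => ∑ j, z j * v j) =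
      gaussianReal 0 (v ⬝ᵥ Sig.mulVec v).toNNReal := by
  have hL : (fun z : EuclideanSpace ℝ (Fin p) => ∑ j, z j * v j) =
      innerSL ℝ (WithLp.toLp 2 v : EuclideanSpace ℝ (Fin p)) := by
    funext z
    rw [innerSL_apply_apply, PiLp.inner_apply]
    simp
  rw [hL, IsGaussian.map_eq_gaussianReal, ContinuousLinearMap.integral_comp_id_comm
    IsGaussian.integrable_id, integral_id_multivariateGaussian, map_zero]
  congr 2
  have h := covarianceBilin_self (μ := multivariateGaussian 0 Sig) IsGaussian.memLp_two_id
    (WithLp.toLp 2 v : EuclideanSpace ℝ (Fin p))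
  rw [covarianceBilin_multivariateGaussian hS] at h
  rw [h]
  rfl

instance (Sig : Matrix (Fin p) (Fin p) ℝ) : IsProbabilityMeasure (gaussianEnsemble n Sig) := by
  unfold gaussianEnsemble
  infer_instance

/-- The moment generating function of `‖A v‖²` for a Gaussian design `A`. -/
theorem mgf_sq_gaussianEnsemble {Sig : Matrix (Fin p) (Fin p) ℝ} (hS : Sig.PosSemidef)
    {v : Fin p → ℝ} (hq : 0 < v ⬝ᵥ Sig.mulVec v) {t : ℝ} (ht : 2 * t * (v ⬝ᵥ Sig.mulVec v) < 1) :
    mgf (fun Z => ∑ r, ((ofRows Z).mulVec v) r ^ 2) (gaussianEnsemble n Sig) t =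
      (√(1 - 2 * t * (v ⬝ᵥ Sig.mulVec v)))⁻¹ ^ n := by
  set q := v ⬝ᵥ Sig.mulVec v with hqdef
  have hprod : ∀ Z : Fin n → EuclideanSpace ℝ (Fin p),
      Real.exp (t * ∑ r, ((ofRows Z).mulVec v) r ^ 2) =
        ∏ r, Real.exp (t * (∑ j, Z r j * v j) ^ 2) := by
    intro Z
    rw [← Real.exp_sum, Finset.mul_sum]
    rfl
  rw [mgf]
  simp_rw [hprod]
  rw [gaussianEnsemble, integral_fintype_prod_eq_prod
    (fun (_ : Fin n) (z : EuclideanSpace ℝ (Fin p)) => Real.exp (t * (∑ j, z j * v j) ^ 2)),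
    Finset.prod_const, Finset.card_univ, Fintype.card_fin]
  congr 1
  have hmeas : Measurable fun z : EuclideanSpace ℝ (Fin p) => ∑ j, z j * v j := by fun_prop
  rw [← integral_map (φ := fun z : EuclideanSpace ℝ (Fin p) => ∑ j, z j * v j)
    (f := fun x : ℝ => Real.exp (t * x ^ 2)) hmeas.aemeasurable
    (by fun_prop), map_dotProduct_multivariateGaussian hS,
    integral_exp_mul_sq_gaussianReal (by simpa using hq) (by rwa [Real.coe_toNNReal _ hq.le]),
    Real.coe_toNNReal _ hq.le]

/-- A nonintegrable function has Bochner integral 0, whereas the moment generating function is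
positive. -/
theorem integrable_exp_sq_gaussianEnsemble {Sig : Matrix (Fin p) (Fin p) ℝ} (hS : Sig.PosSemidef)
    {v : Fin p → ℝ} (hq : 0 < v ⬝ᵥ Sig.mulVec v) {t : ℝ} (ht : 2 * t * (v ⬝ᵥ Sig.mulVec v) < 1) :
    Integrable (fun Z => Real.exp (t * ∑ r, ((ofRows Z).mulVec v) r ^ 2))
      (gaussianEnsemble n Sig) := by
  refine Integrable.of_integral_ne_zero ?_
  have h := mgf_sq_gaussianEnsemble (n := n) hS hq ht
  rw [mgf] at h
  rw [h]
  have : 0 < √(1 - 2 * t * (v ⬝ᵥ Sig.mulVec v)) := Real.sqrt_pos.2 (by linarith)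
  positivity

theorem measureReal_sq_le_mul_gaussianEnsemble {Sig : Matrix (Fin p) (Fin p) ℝ} (hS : Sig.PosSemidef)
    {v : Fin p → ℝ} (hq : 0 < v ⬝ᵥ Sig.mulVec v) :
    (gaussianEnsemble n Sig).real
      {Z | ∑ r, ((ofRows Z).mulVec v) r ^ 2 ≤ (v ⬝ᵥ Sig.mulVec v) / 8 * n} ≤
      Real.exp (-(n / 2)) := by
  set q := v ⬝ᵥ Sig.mulVec v with hqdef
  -- Chernoff with t = -4/q: the moment generating function is 3^(-n) ≤ e^(-n), against a prefactor
  -- e^(n/2).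
  have ht : 2 * (-4 / q) * q = -8 := by field_simp; norm_num
  refine (measure_le_le_exp_mul_mgf (t := -4 / q) _ (by
    rw [neg_div]; exact neg_nonpos.2 (by positivity))
    (integrable_exp_sq_gaussianEnsemble hS hq (by rw [← hqdef, ht]; norm_num))).trans ?_
  rw [mgf_sq_gaussianEnsemble hS hq (by rw [← hqdef, ht]; norm_num), ← hqdef, ht,
    show (1 - -8 : ℝ) = 3 ^ 2 by norm_num, Real.sqrt_sq (by norm_num)]
  have h3 : (3 : ℝ)⁻¹ ≤ Real.exp (-1) := by
    rw [Real.exp_neg]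
    exact inv_anti₀ (Real.exp_pos 1) Real.exp_one_lt_three.le
  calc _ ≤ Real.exp (-(-4 / q) * (q / 8 * n)) * Real.exp (-1) ^ n := by gcongr
    _ = _ := by
      rw [← Real.exp_nat_mul, ← Real.exp_add]
      congr 1
      field_simp
      ring

theorem measureReal_mul_le_sq_gaussianEnsemble {Sig : Matrix (Fin p) (Fin p) ℝ} (hS : Sig.PosSemidef)
    {v : Fin p → ℝ} (hq : 0 < v ⬝ᵥ Sig.mulVec v) :
    (gaussianEnsemble n Sig).real
      {Z | v ⬝ᵥ Sig.mulVec v * 8 * n ≤ ∑ r, ((ofRows Z).mulVec v) r ^ 2} ≤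
      Real.exp (-(n / 2)) := by
  set q := v ⬝ᵥ Sig.mulVec v with hqdef
  -- Chernoff with t = 1/(4q): the moment generating function is 2^(n/2) ≤ e^n, against a prefactor
  -- e^(-2n).
  have ht : 2 * (1 / (4 * q)) * q = 1 / 2 := by field_simp; norm_num
  refine (measure_ge_le_exp_mul_mgf (t := 1 / (4 * q)) _ (by positivity)
    (integrable_exp_sq_gaussianEnsemble hS hq (by rw [← hqdef, ht]; norm_num))).trans ?_
  rw [mgf_sq_gaussianEnsemble hS hq (by rw [← hqdef, ht]; norm_num), ← hqdef, ht]
  have h3 : (√(1 - 1 / 2 : ℝ))⁻¹ ≤ Real.exp 1 := by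
    rw [← Real.sqrt_inv, Real.sqrt_le_left (Real.exp_pos 1).le]
    refine le_trans (by norm_num : (1 - 1 / 2 : ℝ)⁻¹ ≤ 2 ^ 2) (pow_le_pow_left₀ zero_le_two ?_ 2)
    linarith [Real.add_one_le_exp (1 : ℝ)]
  calc _ ≤ Real.exp (-(1 / (4 * q)) * (q * 8 * n)) * Real.exp 1 ^ n := by gcongr
    _ = Real.exp (-n) := by
      rw [← Real.exp_nat_mul, ← Real.exp_add]
      congr 1
      field_simp
      ring
    _ ≤ _ := by
      refine Real.exp_le_exp.2 ?_
      have : (0 : ℝ) ≤ n := Nat.cast_nonneg n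
      linarith

/-! ### Restricted strong convexity of Gaussian designs -/

/-- Sparsification is applied to the indefinite form AᵀA - a n I, which `hs` makes nonnegative on
signed sums. By `hL` the defect is at most half of a n ‖z‖², so ‖A z‖² keeps the other half. -/
theorem RSC_bound_of_signedSum {A : Matrix (Fin n) (Fin p) ℝ} (hn : 0 < n) {a β L : ℝ} {D : ℕ}
    (hβ0 : 0 ≤ β) (hD : 1 < D)
    (hs : ∀ (t : Fin D → Fin p) (σ : Fin D → Bool),
      a * n * ∑ j, signedSum t σ j ^ 2 ≤ ∑ r, (A.mulVec (signedSum t σ)) r ^ 2)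
    (ha : 0 ≤ a) (hβ : ∀ j, ∑ r, (A.mulVec (Pi.single j 1)) r ^ 2 ≤ β * n)
    (hL : 2 * β * L ≤ a * (D - 1)) {z : Fin p → ℝ} (hz : (∑ j, |z j|) ^ 2 ≤ L * ∑ j, z j ^ 2) :
    a / 4 * ∑ j, z j ^ 2 ≤ 1 / (2 * (n : ℝ)) * ∑ r, (A.mulVec z) r ^ 2 := by
  have hn' : (0 : ℝ) < n := by exact_mod_cast hn
  set B : LinearMap.BilinForm ℝ (Fin p → ℝ) := Matrix.toBilin' (A.transpose * A - (a * n) • 1)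
    with hB
  have hBx : ∀ x, B x x = ∑ r, (A.mulVec x) r ^ 2 - a * n * ∑ j, x j ^ 2 := by
    intro x
    rw [hB, Matrix.toBilin'_apply', Matrix.sub_mulVec, dotProduct_sub, ← Matrix.mulVec_mulVec,
      Matrix.dotProduct_mulVec, Matrix.vecMul_transpose, Matrix.smul_mulVec, Matrix.one_mulVec,
      dotProduct_smul]
    simp only [dotProduct, smul_eq_mul, sq]
  have h := neg_le_of_signedSum_nonneg B (D := D) (β := β * n) (by omega)
    (fun t σ => by rw [hBx]; linarith [hs t σ])
    (fun j => by
      rw [hBx]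
      have : 0 ≤ a * n * ∑ k, (Pi.single j 1 : Fin p → ℝ) k ^ 2 := by positivity
      linarith [hβ j]) z
  rw [hBx] at h
  set E := ∑ j, z j ^ 2 with hE
  have hE0 : 0 ≤ E := Finset.sum_nonneg fun _ _ => sq_nonneg _
  have hD' : (0 : ℝ) < D - 1 := by
    have : (1 : ℝ) < D := by exact_mod_cast hD
    linarith
  have h1 : β * n * (∑ j, |z j|) ^ 2 ≤ β * n * (L * E) :=
    mul_le_mul_of_nonneg_left hz (by positivity)
  have h2 : 2 * β * L * (n * E) ≤ a * (D - 1) * (n * E) :=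
    mul_le_mul_of_nonneg_right hL (by positivity)
  rw [div_mul_eq_mul_div (1 : ℝ), one_mul, le_div_iff₀ (by positivity)]
  refine le_of_mul_le_mul_left ?_ hD'
  linarith

/-- With high probability a Gaussian design is bounded below on all sums of `D` signed basis
vectors and bounded above on the basis. -/
theorem measureReal_bad_design_le {Sig : Matrix (Fin p) (Fin p) ℝ} (hS : Sig.PosSemidef)
    {a₁ a₂ : ℝ} (ha₁ : 0 < a₁)
    (hSig : ∀ v : Fin p → ℝ, a₁ * ∑ j, v j ^ 2 ≤ v ⬝ᵥ Sig.mulVec v ∧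
      v ⬝ᵥ Sig.mulVec v ≤ a₂ * ∑ j, v j ^ 2) {D : ℕ} (hD : 0 < D) :
    (gaussianEnsemble n Sig).real
      {Z | ¬ ((∀ (t : Fin D → Fin p) (σ : Fin D → Bool),
          a₁ / 8 * n * ∑ j, signedSum t σ j ^ 2 ≤
            ∑ r, ((ofRows Z).mulVec (signedSum t σ)) r ^ 2) ∧
        ∀ j, ∑ r, ((ofRows Z).mulVec (Pi.single j 1)) r ^ 2 ≤ 8 * a₂ * n)} ≤
      2 * (2 * p : ℝ) ^ D * Real.exp (-(n / 2)) := by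
  have hn' : (0 : ℝ) ≤ n := Nat.cast_nonneg n
  have hpos : ∀ v : Fin p → ℝ, v ≠ 0 → 0 < v ⬝ᵥ Sig.mulVec v := by
    intro v hv
    obtain ⟨j, hj⟩ := Function.ne_iff.1 hv
    have h2 : 0 < ∑ j, v j ^ 2 :=
      Finset.sum_pos' (fun _ _ => sq_nonneg _) ⟨j, Finset.mem_univ _, by
        have : v j ≠ 0 := hj
        positivity⟩
    exact (mul_pos ha₁ h2).trans_le (hSig v).1
  set bad₁ : (Fin D → Fin p) × (Fin D → Bool) → Set (Fin n → EuclideanSpace ℝ (Fin p)) := fun c =>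
    {Z | ∑ r, ((ofRows Z).mulVec (signedSum c.1 c.2)) r ^ 2 <
      a₁ / 8 * n * ∑ j, signedSum c.1 c.2 j ^ 2} with hbad₁
  set bad₂ : Fin p → Set (Fin n → EuclideanSpace ℝ (Fin p)) := fun j =>
    {Z | 8 * a₂ * n < ∑ r, ((ofRows Z).mulVec (Pi.single j 1)) r ^ 2} with hbad₂
  have h₁ : ∀ c, (gaussianEnsemble n Sig).real (bad₁ c) ≤ Real.exp (-(n / 2)) := by
    intro c
    -- Opposite signs may cancel; the required bound is then trivial.
    by_cases hc : signedSum c.1 c.2 = 0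
    · have : bad₁ c = ∅ := by simp [hbad₁, hc]
      rw [this, measureReal_empty]
      positivity
    · refine le_trans (measureReal_mono ?_) (measureReal_sq_le_mul_gaussianEnsemble hS (hpos _ hc))
      intro Z hZ
      have h3 := mul_le_mul_of_nonneg_right (hSig (signedSum c.1 c.2)).1 hn'
      have h4 : ∑ r, ((ofRows Z).mulVec (signedSum c.1 c.2)) r ^ 2 <
        a₁ / 8 * n * ∑ j, signedSum c.1 c.2 j ^ 2 := hZ
      simp only [Set.mem_ofPred_eq]
      linarith
  have h₂ : ∀ j, (gaussianEnsemble n Sig).real (bad₂ j) ≤ Real.exp (-(n / 2)) := by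
    intro j
    have hne : (Pi.single j 1 : Fin p → ℝ) ≠ 0 := by simp
    refine le_trans (measureReal_mono ?_) (measureReal_mul_le_sq_gaussianEnsemble hS (hpos _ hne))
    intro Z hZ
    have h3 := mul_le_mul_of_nonneg_right (hSig (Pi.single j 1)).2 hn'
    have h4 : 8 * a₂ * n < ∑ r, ((ofRows Z).mulVec (Pi.single j 1)) r ^ 2 := hZ
    have h5 : ∑ k, (Pi.single j (1 : ℝ) : Fin p → ℝ) k ^ 2 = 1 := by simp [Pi.single_apply]
    rw [h5] at h3
    simp only [Set.mem_ofPred_eq]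
    linarith
  have hsub : {Z : Fin n → EuclideanSpace ℝ (Fin p) |
      ¬ ((∀ (t : Fin D → Fin p) (σ : Fin D → Bool),
          a₁ / 8 * n * ∑ j, signedSum t σ j ^ 2 ≤
            ∑ r, ((ofRows Z).mulVec (signedSum t σ)) r ^ 2) ∧
        ∀ j, ∑ r, ((ofRows Z).mulVec (Pi.single j 1)) r ^ 2 ≤ 8 * a₂ * n)} ⊆
      (⋃ c, bad₁ c) ∪ ⋃ j, bad₂ j := by
    intro Z hZ
    by_contra hcon
    simp only [hbad₁, hbad₂, Set.mem_union, Set.mem_iUnion, Set.mem_ofPred_eq, not_or,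
      not_exists, not_lt] at hcon
    exact hZ ⟨fun t σ => hcon.1 (t, σ), hcon.2⟩
  have hcard : (p : ℝ) ≤ (2 * p) ^ D := by
    have h1 : p ≤ (2 * p) ^ D := by
      rcases Nat.eq_zero_or_pos p with rfl | hp
      · exact Nat.zero_le _
      · exact le_trans (by omega : p ≤ 2 * p) (Nat.le_self_pow hD.ne' _)
    exact_mod_cast h1
  refine (measureReal_mono hsub).trans ((measureReal_union_le _ _).trans ?_)
  have e₁ := (measureReal_iUnion_fintype_le (μ := gaussianEnsemble n Sig) bad₁).trans
    (Finset.sum_le_sum fun c _ => h₁ c)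
  have e₂ := (measureReal_iUnion_fintype_le (μ := gaussianEnsemble n Sig) bad₂).trans
    (Finset.sum_le_sum fun j _ => h₂ j)
  simp only [Finset.sum_const, Finset.card_univ, Fintype.card_prod, Fintype.card_fun,
    Fintype.card_fin, Fintype.card_bool, nsmul_eq_mul] at e₁ e₂
  push_cast at e₁
  rw [mul_comm ((p : ℝ) ^ D), ← mul_pow] at e₁
  have h3 := mul_le_mul_of_nonneg_right hcard (Real.exp_pos (-((n : ℝ) / 2))).le
  linarith

/-- The number of signed sums is absorbed by the sample size. -/
theorem two_mul_pow_le_exp {s D : ℕ} {M : ℝ} (hp : 0 < p) (hs : s ≤ p) (hD : (D : ℝ) ≤ M * s)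
    (hM : 0 ≤ M) : (2 * p : ℝ) ^ D ≤ Real.exp (M + 2 * M * (s * Real.log p)) := by
  have hp' : (1 : ℝ) ≤ p := by exact_mod_cast hp
  have hlog : 0 ≤ Real.log p := Real.log_nonneg hp'
  have hl2 : Real.log 2 ≤ 1 := by linarith [Real.log_two_lt_d9]
  rw [← Real.log_le_log_iff (by positivity) (Real.exp_pos _), Real.log_exp, Real.log_pow,
    Real.log_mul two_ne_zero (by positivity)]
  -- For p = 1 the logarithm of p vanishes and cannot absorb log 2; the additive M covers this case.
  rcases (show p = 1 ∨ 1 < p by omega) with rfl | h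
  · have hs' : (s : ℝ) ≤ 1 := by exact_mod_cast hs
    have hDM : (D : ℝ) ≤ M := hD.trans (mul_le_of_le_one_right hM hs')
    have := mul_le_mul hDM hl2 (Real.log_nonneg one_le_two) hM
    simp only [Nat.cast_one, Real.log_one, add_zero, mul_zero]
    linarith
  · have h2 : Real.log 2 ≤ Real.log p := Real.log_le_log two_pos (by exact_mod_cast h)
    have h3 : (D : ℝ) * (Real.log 2 + Real.log p) ≤ D * (2 * Real.log p) :=
      mul_le_mul_of_nonneg_left (by linarith) (Nat.cast_nonneg _)
    have h4 := mul_le_mul_of_nonneg_right hD (by linarith : 0 ≤ 2 * Real.log p)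
    linarith

/-- On the cone the squared ℓ¹ norm is at most C s ‖z‖², where s counts the coordinates of the
supporting groups, so signed sums of length about M s suffice. Their number has logarithm of order s
log p, which the sample size dominates. -/
theorem exists_gaussian_RSC_constants {tb : ℝ} (htb : tb < 1) (a₁ a₂ γ : ℝ) (ha₁ : 0 < a₁)
    (ha₁₂ : a₁ ≤ a₂) (hγ : 0 < γ) :
    ∃ κ c c₁ c₂ : ℝ, 0 < κ ∧ 0 < c ∧ 0 < c₁ ∧ 0 < c₂ ∧
      ∀ (n p m : ℕ) (grp : Fin p → Fin m) (Sig : Matrix (Fin p) (Fin p) ℝ) (xbar : Fin p → ℝ),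
        xbar ≠ 0 → Sig.PosDef →
        (∀ v : Fin p → ℝ, a₁ * ∑ j, v j ^ 2 ≤ v ⬝ᵥ Sig.mulVec v ∧
          v ⬝ᵥ Sig.mulVec v ≤ a₂ * ∑ j, v j ^ 2) →
        (maxGroupSize grp : ℝ) * (groupSupport grp xbar).card
          ≤ γ * ∑ i ∈ groupSupport grp xbar, (groupSize grp i : ℝ) →
        c * (∑ i ∈ groupSupport grp xbar, (groupSize grp i : ℝ)) * Real.log p < n →
        1 - c₁ * Real.exp (-c₂ * n) < (gaussianEnsemble n Sig).real
          {Z | RSC (ofRows Z) κ (cone tb grp (groupSupport grp xbar)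
                (1.5 * (groupSupport grp xbar).card))} := by
  set C : ℝ := (1 + 2 / (1 - tb)) ^ 2 * (1.5 * γ) with hC
  have hC0 : 0 < C := by
    have : 0 < 2 / (1 - tb) := div_pos two_pos (by linarith)
    positivity
  have ha₂ : 0 < a₂ := ha₁.trans_le ha₁₂
  set M : ℝ := 2 * (8 * a₂) * C / (a₁ / 8) with hM
  have hM0 : 0 < M := by positivity
  refine ⟨a₁ / 8 / 4, 8 * (M + 2), 3 * Real.exp (M + 2), 1 / 4, by positivity, by positivity,
    by positivity, by positivity, ?_⟩
  intro n p m grp Sig xbar hx0 hSig hbd hgrp hlarge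
  set S := groupSupport grp xbar with hS
  set s := ∑ i ∈ S, groupSize grp i with hs
  have hscast : ∑ i ∈ S, (groupSize grp i : ℝ) = s := by rw [hs]; push_cast; rfl
  rw [hscast] at hgrp hlarge
  have hs1 : 1 ≤ s := one_le_sum_groupSize hx0
  have hsp : s ≤ p := sum_groupSize_le grp S
  have hp : 0 < p := by omega
  have hs1' : (1 : ℝ) ≤ s := by exact_mod_cast hs1
  have hlog : 0 ≤ Real.log p := Real.log_nonneg (by exact_mod_cast hp)
  have hn : 0 < n := by
    have : (0 : ℝ) < n := lt_of_le_of_lt (by positivity) hlarge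
    exact_mod_cast this
  -- The extra 1 gives D - 1 ≥ M s, the form in which sparsification uses D; since s ≥ 1, still D ≤
  -- (M + 2) s.
  set D := ⌈M * s⌉₊ + 1 with hD
  have hceil : 0 < ⌈M * s⌉₊ := Nat.ceil_pos.2 (by positivity)
  have hDM : M * s ≤ (D : ℝ) - 1 := by
    rw [hD]; push_cast
    linarith [Nat.le_ceil (M * s)]
  have hDM' : (D : ℝ) ≤ (M + 2) * s := by
    rw [hD]; push_cast
    linarith [(Nat.ceil_lt_add_one (by positivity : 0 ≤ M * s))]
  have hbad := measureReal_bad_design_le (n := n) hSig.posSemidef ha₁ hbd (D := D) (by omega)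
  set bad := {Z : Fin n → EuclideanSpace ℝ (Fin p) |
    ¬ ((∀ (t : Fin D → Fin p) (σ : Fin D → Bool),
          a₁ / 8 * n * ∑ j, signedSum t σ j ^ 2 ≤
            ∑ r, ((ofRows Z).mulVec (signedSum t σ)) r ^ 2) ∧
        ∀ j, ∑ r, ((ofRows Z).mulVec (Pi.single j 1)) r ^ 2 ≤ 8 * a₂ * n)} with hbaddef
  set good := {Z : Fin n → EuclideanSpace ℝ (Fin p) |
    RSC (ofRows Z) (a₁ / 8 / 4) (cone tb grp S (1.5 * S.card))} with hgood
  -- Subadditivity on a cover makes measurability of the two events unnecessary.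
  have hcover : (Set.univ : Set (Fin n → EuclideanSpace ℝ (Fin p))) ⊆ good ∪ bad := by
    intro Z _
    by_cases hZ : Z ∈ bad
    · exact Or.inr hZ
    · refine Or.inl fun z hz => ?_
      obtain ⟨h1, h2⟩ := not_not.1 hZ
      refine RSC_bound_of_signedSum hn (a := a₁ / 8) (β := 8 * a₂) (L := C * s) (D := D)
        (by positivity) (by omega) h1 (by positivity) h2 ?_ ?_
      · have h3 := mul_le_mul_of_nonneg_left hDM (by positivity : 0 ≤ a₁ / 8)
        have h4 : a₁ / 8 * (M * s) = 2 * (8 * a₂) * (C * s) := by rw [hM]; field_simp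
        linarith
      · refine (sq_sum_abs_le_of_mem_cone htb hz).trans ?_
        refine mul_le_mul_of_nonneg_right ?_ (Finset.sum_nonneg fun _ _ => sq_nonneg _)
        rw [hC, mul_assoc]
        refine mul_le_mul_of_nonneg_left ?_ (sq_nonneg _)
        linarith
  have h1 : 1 ≤ (gaussianEnsemble n Sig).real good + (gaussianEnsemble n Sig).real bad := by
    refine le_trans ?_ ((measureReal_mono hcover).trans (measureReal_union_le _ _))
    simp
  have h2 := two_mul_pow_le_exp hp hsp hDM' (by positivity)
  -- The choice c = 8 (M + 2) lets the count of signed sums use up only e^(n/4) of the decay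
  -- e^(-n/2); the 3 in place of 2 makes the inequality strict.
  have h3 : 2 * (2 * p : ℝ) ^ D * Real.exp (-(n / 2)) <
      3 * Real.exp (M + 2) * Real.exp (-(1 / 4) * n) := by
    calc _ ≤ 2 * Real.exp (M + 2 + n / 4) * Real.exp (-(n / 2)) := by
          gcongr
          refine h2.trans (Real.exp_le_exp.2 ?_)
          linarith
      _ = 2 * (Real.exp (M + 2) * Real.exp (-(1 / 4) * n)) := by
          rw [mul_assoc, ← Real.exp_add, ← Real.exp_add]
          congr 2
          ring
      _ < _ := by
          have : 0 < Real.exp (M + 2) * Real.exp (-(1 / 4) * n) := by positivity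
          linarith
  linarith

end

theorem corollary4p2 (φ : ℝ → EReal) (hφ : MemPhi φ) :
    -- fixed designs with restricted strong convexity
    (∀ (n p m : ℕ) (grp : Fin p → Fin m) (A : Matrix (Fin n) (Fin p) ℝ) (xbar : Fin p → ℝ) (κ : ℝ),
      xbar ≠ 0 → 0 < κ →
      RSC A κ (cone (tBar φ) grp (groupSupport grp xbar) (1.5 * (groupSupport grp xbar).card)) →
      OracleRecovery.{u} φ grp A κ xbar) ∧
    -- Gaussian designs with sufficiently many rows
    (∀ a₁ a₂ γ : ℝ, 0 < a₁ → a₁ ≤ a₂ → 0 < γ →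
      ∃ κ c c₁ c₂ : ℝ, 0 < κ ∧ 0 < c ∧ 0 < c₁ ∧ 0 < c₂ ∧
        ∀ (n p m : ℕ) (grp : Fin p → Fin m) (Sig : Matrix (Fin p) (Fin p) ℝ) (xbar : Fin p → ℝ),
          xbar ≠ 0 → Sig.PosDef →
          (∀ v : Fin p → ℝ, a₁ * ∑ j, v j ^ 2 ≤ v ⬝ᵥ Sig.mulVec v ∧
            v ⬝ᵥ Sig.mulVec v ≤ a₂ * ∑ j, v j ^ 2) →
          (maxGroupSize grp : ℝ) * (groupSupport grp xbar).card
            ≤ γ * ∑ i ∈ groupSupport grp xbar, (groupSize grp i : ℝ) →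
          c * (∑ i ∈ groupSupport grp xbar, (groupSize grp i : ℝ)) * Real.log p < n →
          1 - c₁ * Real.exp (-c₂ * n) < (gaussianEnsemble n Sig).real
            {Z | RSC (ofRows Z) κ (cone (tBar φ) grp (groupSupport grp xbar)
                  (1.5 * (groupSupport grp xbar).card)) ∧
                OracleRecovery.{u} φ grp (ofRows Z) κ xbar}) := by
  refine ⟨fun n p m grp A xbar κ hx0 hκ hRSC => oracleRecovery_of_RSC hφ hx0 hκ hRSC, ?_⟩
  intro a₁ a₂ γ ha₁ ha₁₂ hγ
  obtain ⟨κ, c, c₁, c₂, hκ, hc, hc₁, hc₂, h⟩ :=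
    exists_gaussian_RSC_constants hφ.tBar_lt_one a₁ a₂ γ ha₁ ha₁₂ hγ
  refine ⟨κ, c, c₁, c₂, hκ, hc, hc₁, hc₂, fun n p m grp Sig xbar hx0 hSig hbd hgrp hn => ?_⟩
  refine (h n p m grp Sig xbar hx0 hSig hbd hgrp hn).trans_le (measureReal_mono fun Z hZ => ?_)
  exact ⟨hZ, oracleRecovery_of_RSC hφ hx0 hκ hZ⟩
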